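/- Let $\Gamma$ be a finite bipartite distance-regular graph with vertex set $X$, path-length distance $\partial$, diameter $D\ge 4$, valency $k\ge 3$ and intersection numbers $p^h_{ij}=|\{z:\partial(y,z)=i,\ \partial(z,w)=j\}|$ for $\partial(y,w)=h$; write $c_i=p^i_{1,i-1}$ $(1\le i\le D)$, $c_0=0$, $b_i=p^i_{1,i+1}$ $(0\le i\le D-1)$, $b_D=0$. Let $A_i\in\mathrm{Mat}_X(\mathbb C)$ be the $i$-th distance matrix, $A=A_1$ the adjacency matrix, and $\theta_0>\theta_1>\cdots>\theta_D$ the distinct eigenvalues of $A$. Let $f_0,\dots,f_D\in\mathbb R[\lambda]$ be given by $f_{-1}=0$, $f_0=1$, $\lambda f_i=b_{i-1}f_{i-1}+c_{i+1}f_{i+1}$ $(0\le i\le D-1)$, and let $p_i=f_i+f_{i-2}+f_{i-4}+\cdots$, the sum ending in $f_0$ or $f_1$ according to the parity of $i$ $(0\le i\le D)$. Fix $x\in X$. For $0\le i\le D$ let $E_i^*$ be the diagonal matrix with $(y,y)$-entry $1$ if $\partial(x,y)=i$ and $0$ otherwise, and let $T$ be the subalgebra of $\mathrm{Mat}_X(\mathbb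 C)$ generated by $A,E_0^*,\dots,E_D^*$. A $T$-module is a subspace $W\subseteq\mathbb C^X$ with $TW\subseteq W$; it is irreducible if it is nonzero and contains no $T$-modules besides $0$ and $W$. An irreducible $T$-module $W$ is thin if $\dim E_i^*W\le 1$ for $0\le i\le D$, and its endpoint is $\min\{i: E_i^*W\ne 0\}$. If $W$ is thin with endpoint $2$, its local eigenvalue is the scalar by which $E_2^*A_2E_2^*$ acts on $E_2^*W$. Let $d=\lfloor D/2\rfloor$. Choose $n\in\{1,d\}$ if $D$ is odd, and let $n=1$ if $D$ is even. Let $W$ be a thin irreducible $T$-module with endpoint $2$ and local eigenvalue $$\tilde\theta_n=-1-\frac{b_2b_3}{\theta_n^2-b_2},$$ and let $v$ be a nonzero vector in $E_2^*W$. Then the vectors $E_{i+2}^*A_iv$ $(0\le i\le D-4)$ form a basis of $W$, and with respect to this basis (in this order, the columns being the coordinates of the images of the basis vectors) the matrix representing $A$ is the $(D-3)\times(D-3)$ tridiagonal matrix $$\begin{pmatrix}0&\omega_1&&&\mathbf 0\\ c_1&0&\omega_2&&\\ &c_2&\ddots&\ddots&\\ &&\ddots&\ddots&\omega_{D-4}\\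 \mathbf 0&&&c_{D-4}&0\end{pmatrix},\qquad \omega_i=\frac{b_{i+1}c_{i+2}}{c_i}\,\frac{p_{i-1}(\theta_n)\,p_{i+2}(\theta_n)}{p_i(\theta_n)\,p_{i+1}(\theta_n)}\quad(1\le i\le D-4),$$ where the denominators $c_i$, $p_i(\theta_n)$, $p_{i+1}(\theta_n)$ in $\omega_i$ are nonzero for $1\le i\le D-4$. -/

import Mathlib

open scoped Matrix Polynomial

namespace DRG

variable {X : Type*} [Fintype X]

section Combinatorics

/-- The number of vertices at distance `i` from `y` and at distance `j` from `z`. -/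
noncomputable def sphereCount (Γ : SimpleGraph X) (y z : X) (i j : ℕ) : ℕ :=
  (Finset.univ.filter fun w : X => Γ.dist y w = i ∧ Γ.dist w z = j).card

/-- A connected graph of diameter `D` is distance-regular if, for all `0 ≤ h, i, j ≤ D`, the number
of vertices at distance `i` from `y` and `j` from `z` is the same for all pairs `y, z` at
distance `h`. -/
structure IsDistanceRegular (Γ : SimpleGraph X) : Prop where
  connected : Γ.Connected
  regular : ∀ h i j : ℕ, h ≤ Γ.diam → i ≤ Γ.diam → j ≤ Γ.diam →
    ∃ m : ℕ, ∀ y z : X, Γ.dist y z = h → sphereCount Γ y z i j = m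

open Classical in
/-- The intersection number `p^h_{ij}`, evaluated at an arbitrary pair of vertices at distance `h`
(and `0` if there is no such pair). -/
noncomputable def intersectionNumber (Γ : SimpleGraph X) (h i j : ℕ) : ℕ :=
  if H : ∃ q : X × X, Γ.dist q.1 q.2 = h then sphereCount Γ H.choose.1 H.choose.2 i j else 0

/-- In a distance-regular graph the intersection number does not depend on the chosen pair. -/
theorem IsDistanceRegular.sphereCount_eq {Γ : SimpleGraph X} (hΓ : IsDistanceRegular Γ)
    {h i j : ℕ} (hh : h ≤ Γ.diam) (hi : i ≤ Γ.diam) (hj : j ≤ Γ.diam) {y z : X}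
    (hyz : Γ.dist y z = h) : sphereCount Γ y z i j = intersectionNumber Γ h i j := by
  obtain ⟨m, hm⟩ := hΓ.regular h i j hh hi hj
  have H : ∃ q : X × X, Γ.dist q.1 q.2 = h := ⟨(y, z), hyz⟩
  rw [intersectionNumber, dif_pos H, hm y z hyz, hm _ _ H.choose_spec]

/-- `c_i = p^i_{1,i-1}` for `i ≥ 1`, and `c_0 = 0`. -/
noncomputable def c (Γ : SimpleGraph X) : ℕ → ℕ
  | 0 => 0
  | i + 1 => intersectionNumber Γ (i + 1) 1 i

/-- `b_i = p^i_{1,i+1}`; this gives `b_D = 0`, and `b_0` is the valency. -/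
noncomputable def b (Γ : SimpleGraph X) (i : ℕ) : ℕ :=
  intersectionNumber Γ i 1 (i + 1)

/-- The polynomials `f_i` with `f_0 = 1`, `f_{-1} = 0` and
`λ f_i = b_{i-1} f_{i-1} + c_{i+1} f_{i+1}`. -/
noncomputable def f (Γ : SimpleGraph X) : ℕ → ℝ[X]
  | 0 => 1
  | 1 => Polynomial.C ((c Γ 1 : ℝ)⁻¹) * Polynomial.X
  | i + 2 => Polynomial.C ((c Γ (i + 2) : ℝ)⁻¹) *
      (Polynomial.X * f Γ (i + 1) - Polynomial.C (b Γ i : ℝ) * f Γ i)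

/-- The polynomial `p_i = f_i + f_{i-2} + f_{i-4} + ⋯`, ending in `f_0` or `f_1`. -/
noncomputable def p (Γ : SimpleGraph X) (i : ℕ) : ℝ[X] :=
  ∑ h ∈ (Finset.range (i + 1)).filter (fun h => h % 2 = i % 2), f Γ h

/-- `ω_i = (b_{i+1} c_{i+2} / c_i) · p_{i-1}(t) p_{i+2}(t) / (p_i(t) p_{i+1}(t))`, for `i ≥ 1`. -/
noncomputable def omega (Γ : SimpleGraph X) (t : ℝ) (i : ℕ) : ℝ :=
  ((b Γ (i + 1) : ℝ) * (c Γ (i + 2) : ℝ) / (c Γ i : ℝ)) *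
    (((p Γ (i - 1)).eval t * (p Γ (i + 2)).eval t) / ((p Γ i).eval t * (p Γ (i + 1)).eval t))

/-- `z̃ = -1 - b_2 b_3 / (z² - b_2)`, for real `z` with `z² ≠ b_2`. -/
noncomputable def tilde (Γ : SimpleGraph X) (z : ℝ) : ℝ :=
  -1 - (b Γ 2 : ℝ) * (b Γ 3 : ℝ) / (z ^ 2 - (b Γ 2 : ℝ))

/-- The `i`-th distance matrix, in `Mat_X(ℂ)`. -/
noncomputable def distanceMatrix (Γ : SimpleGraph X) (i : ℕ) : Matrix X X ℂ :=
  Matrix.of fun y z => if Γ.dist y z = i then 1 else 0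

/-- The adjacency matrix `A = A_1`. -/
noncomputable abbrev adjacency (Γ : SimpleGraph X) : Matrix X X ℂ := distanceMatrix Γ 1

end Combinatorics

section Algebra

variable [DecidableEq X]

/-- `θ_i`, where `θ_0 > θ_1 > ⋯` are the distinct eigenvalues of `A` (all of them are real). -/
noncomputable def eigenvalue (Γ : SimpleGraph X) (i : ℕ) : ℝ :=
  ((Matrix.finite_real_spectrum (A := adjacency Γ)).toFinset.sort (fun s t => s ≥ t)).getD i 0

/-- The `i`-th dual idempotent `E*_i` with respect to `x`. -/
noncomputable def dualIdempotent (Γ : SimpleGraph X) (x : X) (i : ℕ) : Matrix X X ℂ :=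
  Matrix.diagonal fun y => if Γ.dist x y = i then 1 else 0

/-- The subconstituent algebra `T = T(x)`, generated by `A` and the dual idempotents. -/
noncomputable def subconstituentAlgebra (Γ : SimpleGraph X) (x : X) :
    Subalgebra ℂ (Matrix X X ℂ) :=
  Algebra.adjoin ℂ (insert (adjacency Γ) (Set.range (dualIdempotent Γ x)))

/-- A `T`-module: a subspace `W` of the standard module `V = ℂ^X` with `B W ⊆ W` for `B ∈ T`. -/
def IsTModule (Γ : SimpleGraph X) (x : X) (W : Submodule ℂ (X → ℂ)) : Prop :=
  ∀ B ∈ subconstituentAlgebra Γ x, ∀ w ∈ W, B *ᵥ w ∈ W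

/-- An irreducible `T`-module: nonzero, and containing no `T`-modules besides `0` and itself. -/
structure IsIrreducibleTModule (Γ : SimpleGraph X) (x : X) (W : Submodule ℂ (X → ℂ)) : Prop where
  isTModule : IsTModule Γ x W
  ne_bot : W ≠ ⊥
  eq_bot_or_eq : ∀ W' : Submodule ℂ (X → ℂ), W' ≤ W → IsTModule Γ x W' → W' = ⊥ ∨ W' = W

/-- The subspace `E*_i W`. -/
noncomputable def dualComponent (Γ : SimpleGraph X) (x : X) (W : Submodule ℂ (X → ℂ)) (i : ℕ) :
    Submodule ℂ (X → ℂ) :=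
  W.map (dualIdempotent Γ x i).mulVecLin

/-- `W` is thin: `dim E*_i W ≤ 1` for `0 ≤ i ≤ D`. -/
def IsThin (Γ : SimpleGraph X) (x : X) (W : Submodule ℂ (X → ℂ)) : Prop :=
  ∀ i ≤ Γ.diam, Module.finrank ℂ (dualComponent Γ x W i) ≤ 1

/-- The endpoint of `W`: the least `i` with `0 ≤ i ≤ D` and `E*_i W ≠ 0`. -/
noncomputable def endpoint (Γ : SimpleGraph X) (x : X) (W : Submodule ℂ (X → ℂ)) : ℕ :=
  sInf {i | i ≤ Γ.diam ∧ dualComponent Γ x W i ≠ ⊥}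

/-- `E*_2 W` is nonzero and `E*_2 A_2 E*_2` acts on it as the scalar `η`. -/
def HasLocalEigenvalue (Γ : SimpleGraph X) (x : X) (W : Submodule ℂ (X → ℂ)) (η : ℝ) : Prop :=
  dualComponent Γ x W 2 ≠ ⊥ ∧
    ∀ u ∈ dualComponent Γ x W 2,
      (dualIdempotent Γ x 2 * distanceMatrix Γ 2 * dualIdempotent Γ x 2) *ᵥ u = (η : ℂ) • u

/-- The action of `A` on a `T`-module `W`. -/
noncomputable def adjacencyOn (Γ : SimpleGraph X) (x : X) (W : Submodule ℂ (X → ℂ))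
    (hW : IsTModule Γ x W) : W →ₗ[ℂ] W :=
  (adjacency Γ).mulVecLin.restrict fun w hw =>
    hW _ (Algebra.subset_adjoin (Set.mem_insert _ _)) w hw

/-- The `(D-3) × (D-3)` tridiagonal matrix with zero diagonal, subdiagonal `c_1, …, c_{D-4}` and
superdiagonal `ω_1, …, ω_{D-4}`. Rows and columns are indexed by `0, …, D-4`. -/
noncomputable def tridiagonal (Γ : SimpleGraph X) (t : ℝ) :
    Matrix (Fin (Γ.diam - 3)) (Fin (Γ.diam - 3)) ℂ :=
  Matrix.of fun r s =>
    if (r : ℕ) = (s : ℕ) + 1 then (c Γ r : ℂ)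
    else if (s : ℕ) = (r : ℕ) + 1 then ((omega Γ t s : ℝ) : ℂ)
    else 0

end Algebra

end DRG

/-!
Write `u_r = E*_{r+2} A_r v` and let `t` be an eigenvalue of `A` with `t² ≠ k²`, `t² ≠ b_2` and
`t ≠ 0`. Since `v` is orthogonal to the all-ones vector, `E*_{r+2} (A_r + A_{r+2} + A_{r+4}) v = 0`.
Hence, once `E*_{r+2} A_{r+4} v` is known to be a multiple `-α_r u_r`, the identity
`A A_{r+1} = b_r A_r + c_{r+2} A_{r+2}` expresses both components of `A u_{r+1}` through `u_r` and
`u_{r+2}`. The local eigenvalue gives `α_0`, and thinness propagates proportionality from `r` to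
`r + 1`: comparing the two ways of lowering `E*_{r+3} A_{r+5} v` yields a recurrence for `α_r`,
which the three-term recurrence of the polynomials `p_i` solves, with lowering coefficients
`ω_r`. No `u_r` with `r ≤ D - 4` vanishes, as otherwise the preceding ones would already span `W`.

Finally `(λ² - k²) p_{D-1}` is a multiple of the minimal polynomial of `A`, so `p_{D-1}(t) = 0`
and `ω_{D-3} = 0`; as lowering is adjoint to raising, this forces `u_{D-3} = 0`, and `W` is the span
of `u_0, …, u_{D-4}`.

That `t = θ_1` and, for odd `D`, `t = θ_d` qualify follows from
`trace ((A² - k²) (A² - b_2)) = 0`: the summands of this trace cannot all vanish, and as they do not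
all have the same sign there are eigenvalues with `b_2 < t² < k²` and with `t² < b_2`.
-/

namespace DRG

section Distances

variable {X : Type*} {Γ : SimpleGraph X}

theorem exists_dist_eq_and_dist_eq (hc : Γ.Connected) {y z : X} {i j : ℕ}
    (h : Γ.dist y z = i + j) : ∃ w, Γ.dist y w = i ∧ Γ.dist w z = j := by
  obtain ⟨q, hq⟩ := hc.exists_walk_length_eq_dist y z
  have htake : Γ.dist y (q.getVert i) ≤ i :=
    (SimpleGraph.dist_le (q.take i)).trans (by rw [SimpleGraph.Walk.take_length]; omega)
  have hdrop : Γ.dist (q.getVert i) z ≤ j :=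
    (SimpleGraph.dist_le (q.drop i)).trans (by rw [SimpleGraph.Walk.drop_length]; omega)
  have htri := hc.dist_triangle (u := y) (v := q.getVert i) (w := z)
  exact ⟨q.getVert i, by omega, by omega⟩

theorem exists_dist_eq [Finite X] (hc : Γ.Connected) {i : ℕ} (hi : i ≤ Γ.diam) :
    ∃ y z, Γ.dist y z = i := by
  have := hc.nonempty
  obtain ⟨y, z, hyz⟩ := Γ.exists_dist_eq_diam
  obtain ⟨w, hw, -⟩ := exists_dist_eq_and_dist_eq hc (hyz.trans (Nat.add_sub_of_le hi).symm)
  exact ⟨y, w, hw⟩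

theorem dist_le_diam [Finite X] (hc : Γ.Connected) (y z : X) : Γ.dist y z ≤ Γ.diam :=
  have := hc.nonempty
  SimpleGraph.dist_le_diam (SimpleGraph.connected_iff_ediam_ne_top.1 hc)

theorem even_dist_add_dist_add_dist (hc : Γ.Connected) (hbip : Γ.IsBipartite) (y w z : X) :
    Even (Γ.dist y w + Γ.dist w z + Γ.dist y z) := by
  obtain ⟨C⟩ := hbip
  let C' : Γ.Coloring Bool := SimpleGraph.recolorOfEquiv Γ finTwoEquiv C
  have even_dist_iff (a b : X) : Even (Γ.dist a b) ↔ (C' a ↔ C' b) := by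
    obtain ⟨q, hq⟩ := hc.exists_walk_length_eq_dist a b
    rw [← hq]
    exact C'.even_length_iff_congr q
  rw [Nat.even_add, Nat.even_add, even_dist_iff, even_dist_iff, even_dist_iff]
  tauto

theorem dist_eq_add_one_or_dist_eq_add_one (hc : Γ.Connected) (hbip : Γ.IsBipartite) {y w : X}
    (hyw : Γ.Adj y w) (z : X) :
    Γ.dist z w = Γ.dist z y + 1 ∨ Γ.dist z y = Γ.dist z w + 1 := by
  have hparity := even_dist_add_dist_add_dist hc hbip z y w
  rw [SimpleGraph.dist_eq_one_iff_adj.2 hyw, Nat.even_iff] at hparity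
  rcases hyw.diff_dist_adj (u := z) with h | h | h <;> omega

end Distances

section IntersectionNumbers

variable {X : Type*} [Fintype X] {Γ : SimpleGraph X} {i : ℕ} {y z : X}

theorem sphereCount_pos {j : ℕ} (w : X) (hyw : Γ.dist y w = i) (hwz : Γ.dist w z = j) :
    0 < sphereCount Γ y z i j :=
  Finset.card_pos.2 ⟨w, by simp [hyw, hwz]⟩

theorem sphereCount_eq_zero_of_diam_lt (hc : Γ.Connected) (y z : X) (i : ℕ) {j : ℕ}
    (hj : Γ.diam < j) : sphereCount Γ y z i j = 0 :=
  Finset.card_eq_zero.2 <| Finset.filter_eq_empty_iff.2 fun w _ hw =>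
    (dist_le_diam hc w z).not_gt (hw.2 ▸ hj)

theorem sphereCount_one_eq_zero (hc : Γ.Connected) (hbip : Γ.IsBipartite)
    (hyz : Γ.dist y z ≠ i + 1) (hyz' : i ≠ Γ.dist y z + 1) : sphereCount Γ y z 1 i = 0 := by
  refine Finset.card_eq_zero.2 (Finset.filter_eq_empty_iff.2 fun w _ hw => ?_)
  have h := dist_eq_add_one_or_dist_eq_add_one hc hbip (SimpleGraph.dist_eq_one_iff_adj.1 hw.1) z
  rw [Γ.dist_comm (u := z) (v := w), Γ.dist_comm (u := z) (v := y), hw.2] at h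
  omega

namespace IsDistanceRegular

theorem b_pos (hΓ : IsDistanceRegular Γ) (hi : i < Γ.diam) : 0 < b Γ i := by
  obtain ⟨w, z, hwz⟩ := exists_dist_eq hΓ.connected (Nat.succ_le_of_lt hi)
  obtain ⟨y, hwy, hyz⟩ := exists_dist_eq_and_dist_eq hΓ.connected (hwz.trans (Nat.add_comm i 1))
  rw [b, ← hΓ.sphereCount_eq hi.le (by omega) hi hyz]
  exact sphereCount_pos w (Γ.dist_comm.trans hwy) hwz

theorem c_pos (hΓ : IsDistanceRegular Γ) (hi : i + 1 ≤ Γ.diam) : 0 < c Γ (i + 1) := by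
  obtain ⟨y, z, hyz⟩ := exists_dist_eq hΓ.connected hi
  obtain ⟨w, hyw, hwz⟩ := exists_dist_eq_and_dist_eq hΓ.connected (hyz.trans (Nat.add_comm i 1))
  rw [c, ← hΓ.sphereCount_eq hi (by omega) (by omega) hyz]
  exact sphereCount_pos w hyw hwz

theorem b_eq_zero (hΓ : IsDistanceRegular Γ) (hi : Γ.diam ≤ i) : b Γ i = 0 := by
  rw [b, intersectionNumber]
  split_ifs with H
  · exact sphereCount_eq_zero_of_diam_lt hΓ.connected _ _ _ (Nat.lt_succ_of_le hi)
  · rfl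

theorem sphereCount_one_succ (hΓ : IsDistanceRegular Γ) (hyz : Γ.dist y z = i) :
    sphereCount Γ y z 1 (i + 1) = b Γ i := by
  rcases Nat.lt_or_ge i Γ.diam with hi | hi
  · exact hΓ.sphereCount_eq hi.le (by omega) hi hyz
  · rw [hΓ.b_eq_zero hi,
      sphereCount_eq_zero_of_diam_lt hΓ.connected _ _ _ (Nat.lt_succ_of_le hi)]

theorem sphereCount_one_pred (hΓ : IsDistanceRegular Γ) (hyz : Γ.dist y z = i + 1) :
    sphereCount Γ y z 1 i = c Γ (i + 1) := by
  have h := dist_le_diam hΓ.connected y z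
  exact hΓ.sphereCount_eq (by omega) (by omega) (by omega) hyz

theorem c_one (hΓ : IsDistanceRegular Γ) (hD : 1 ≤ Γ.diam) : c Γ 1 = 1 := by
  obtain ⟨y, z, hyz⟩ := exists_dist_eq hΓ.connected hD
  rw [← hΓ.sphereCount_one_pred hyz, sphereCount, Finset.card_eq_one]
  refine ⟨z, Finset.ext fun w => ?_⟩
  simp only [Finset.mem_filter, Finset.mem_univ, true_and, Finset.mem_singleton,
    hΓ.connected.dist_eq_zero_iff]
  exact ⟨And.right, fun h => ⟨h ▸ hyz, h⟩⟩

theorem card_neighbors (hΓ : IsDistanceRegular Γ) (y : X) :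
    (Finset.univ.filter fun w => Γ.dist y w = 1).card = b Γ 0 := by
  rw [← hΓ.sphereCount_one_succ (Γ.dist_self (v := y)), sphereCount]
  congr 1
  ext w
  simp [Γ.dist_comm (u := w) (v := y)]

theorem c_add_b (hΓ : IsDistanceRegular Γ) (hbip : Γ.IsBipartite) (hi : i ≤ Γ.diam) :
    c Γ i + b Γ i = b Γ 0 := by
  classical
  rcases i with _ | i
  · simp [c]
  obtain ⟨z, y, hzy⟩ := exists_dist_eq hΓ.connected hi
  have hyz : Γ.dist y z = i + 1 := Γ.dist_comm.trans hzy
  rw [← hΓ.sphereCount_one_pred hyz, ← hΓ.sphereCount_one_succ hyz, ← hΓ.card_neighbors y,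
    sphereCount, sphereCount, ← Finset.card_union_of_disjoint]
  · congr 1
    ext w
    simp only [Finset.mem_union, Finset.mem_filter, Finset.mem_univ, true_and, ← and_or_left,
      and_iff_left_iff_imp]
    intro hyw
    have h := dist_eq_add_one_or_dist_eq_add_one hΓ.connected hbip
      (SimpleGraph.dist_eq_one_iff_adj.1 hyw) z
    rw [Γ.dist_comm (u := w) (v := z)]
    omega
  · exact Finset.disjoint_filter.2 fun w _ h h' => by omega

theorem c_cast_ne_zero (hΓ : IsDistanceRegular Γ) (hi : i + 1 ≤ Γ.diam) :
    (c Γ (i + 1) : ℝ) ≠ 0 :=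
  Nat.cast_ne_zero.2 (hΓ.c_pos hi).ne'

theorem b_cast_ne_zero (hΓ : IsDistanceRegular Γ) (hi : i < Γ.diam) : (b Γ i : ℝ) ≠ 0 :=
  Nat.cast_ne_zero.2 (hΓ.b_pos hi).ne'

theorem c_add_b_cast (hΓ : IsDistanceRegular Γ) (hbip : Γ.IsBipartite) (hi : i ≤ Γ.diam) :
    (c Γ i : ℝ) + b Γ i = b Γ 0 := by
  exact_mod_cast hΓ.c_add_b hbip hi

end IsDistanceRegular

end IntersectionNumbers

section DistanceMatrices

variable {X : Type*} {Γ : SimpleGraph X}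

theorem distanceMatrix_apply (i : ℕ) (y z : X) :
    distanceMatrix Γ i y z = if Γ.dist y z = i then 1 else 0 := rfl

theorem distanceMatrix_zero [DecidableEq X] (hc : Γ.Connected) : distanceMatrix Γ 0 = 1 := by
  ext y z
  simp [distanceMatrix_apply, Matrix.one_apply, hc.dist_eq_zero_iff]

theorem distanceMatrix_isSelfAdjoint (i : ℕ) : IsSelfAdjoint (distanceMatrix Γ i) :=
  Matrix.IsHermitian.ext fun y z => by
    simp [distanceMatrix_apply, Γ.dist_comm (u := z) (v := y), apply_ite (starRingEnd ℂ)]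

theorem distanceMatrix_eq_zero [Finite X] (hc : Γ.Connected) {i : ℕ} (hi : Γ.diam < i) :
    distanceMatrix Γ i = 0 := by
  ext y z
  rw [distanceMatrix_apply, if_neg ((dist_le_diam hc y z).trans_lt hi).ne, Matrix.zero_apply]

variable [Fintype X]

theorem distanceMatrix_mul_distanceMatrix_apply (i j : ℕ) (y z : X) :
    (distanceMatrix Γ i * distanceMatrix Γ j) y z = sphereCount Γ y z i j := by
  simp [Matrix.mul_apply, distanceMatrix_apply, sphereCount, ← ite_and, Finset.sum_boole, and_comm]

namespace IsDistanceRegular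

theorem adjacency_mul_distanceMatrix (hΓ : IsDistanceRegular Γ) (hbip : Γ.IsBipartite) (i : ℕ) :
    adjacency Γ * distanceMatrix Γ (i + 1) =
      (b Γ i : ℝ) • distanceMatrix Γ i + (c Γ (i + 2) : ℝ) • distanceMatrix Γ (i + 2) := by
  ext y z
  rw [distanceMatrix_mul_distanceMatrix_apply, Matrix.add_apply, Matrix.smul_apply,
    Matrix.smul_apply, distanceMatrix_apply, distanceMatrix_apply]
  by_cases hb : Γ.dist y z = i
  · simp [hb, hΓ.sphereCount_one_succ hb]
  by_cases hc : Γ.dist y z = i + 2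
  · simp [hc, hΓ.sphereCount_one_pred hc]
  · simp [hb, hc, sphereCount_one_eq_zero hΓ.connected hbip (i := i + 1) hc (by omega)]

theorem aeval_f [DecidableEq X] (hΓ : IsDistanceRegular Γ) (hbip : Γ.IsBipartite) :
    ∀ i ≤ Γ.diam, Polynomial.aeval (adjacency Γ) (f Γ i) = distanceMatrix Γ i
  | 0, _ => by simp [f, distanceMatrix_zero hΓ.connected]
  | 1, hi => by simp [f, hΓ.c_one hi]
  | i + 2, hi => by
    rw [f, map_mul, map_sub, map_mul, map_mul, Polynomial.aeval_X, Polynomial.aeval_C,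
      Polynomial.aeval_C, aeval_f hΓ hbip (i + 1) (by omega), aeval_f hΓ hbip i (by omega),
      hΓ.adjacency_mul_distanceMatrix hbip, ← Algebra.smul_def, ← Algebra.smul_def,
      add_sub_cancel_left, inv_smul_smul₀ (hΓ.c_cast_ne_zero hi)]

theorem distanceMatrix_mem_subconstituentAlgebra [DecidableEq X] (hΓ : IsDistanceRegular Γ)
    (hbip : Γ.IsBipartite) (x : X) (i : ℕ) :
    distanceMatrix Γ i ∈ subconstituentAlgebra Γ x := by
  rcases Nat.lt_or_ge Γ.diam i with hi | hi
  · exact distanceMatrix_eq_zero hΓ.connected hi ▸ zero_mem _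
  · have hA : adjacency Γ ∈ subconstituentAlgebra Γ x :=
      Algebra.subset_adjoin (Set.mem_insert _ _)
    have aeval_eq := Polynomial.aeval_subalgebra_coe (f Γ i)
      ((subconstituentAlgebra Γ x).restrictScalars ℝ) ⟨adjacency Γ, hA⟩
    rw [hΓ.aeval_f hbip i hi] at aeval_eq
    exact aeval_eq ▸ SetLike.coe_mem _

end IsDistanceRegular

end DistanceMatrices

section Polynomials

open Polynomial

variable {V : Type*} [Fintype V] {Γ : SimpleGraph V}

theorem p_zero : p Γ 0 = 1 := by
  simp [p, f, Finset.sum_filter]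

theorem p_one : p Γ 1 = f Γ 1 := by
  simp [p, Finset.sum_filter, Finset.sum_range_succ]

theorem p_add_two (i : ℕ) : p Γ (i + 2) = f Γ (i + 2) + p Γ i := by
  have hparity : (i + 1) % 2 ≠ i % 2 := by omega
  rw [p, Finset.sum_filter, Finset.sum_range_succ, Finset.sum_range_succ]
  simp [p, Finset.sum_filter, hparity, add_comm]

/-- The polynomial `λ f_D - b_{D-1} f_{D-1}` of degree `D + 1` that annihilates the adjacency
matrix; the truncated subtraction matters only for `D = 0`. -/
noncomputable def annihilator (Γ : SimpleGraph V) : ℝ[X] :=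
  X * f Γ Γ.diam - (b Γ (Γ.diam - 1) : ℝ[X]) * f Γ (Γ.diam - 1)

theorem degree_X_mul_sub_C_mul {R : Type*} [CommRing R] [NoZeroDivisors R] {g h : R[X]}
    (hgh : h.degree < g.degree + 1) (a : R) : (X * g - C a * h).degree = g.degree + 1 := by
  nontriviality R
  have hX : (X * g).degree = g.degree + 1 := by rw [degree_mul, degree_X, add_comm]
  rw [degree_sub_eq_left_of_degree_lt, hX]
  rw [hX, ← smul_eq_C_mul]
  exact (degree_smul_le _ _).trans_lt hgh

namespace IsDistanceRegular

variable {i : ℕ}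

theorem f_one (hΓ : IsDistanceRegular Γ) (hD : 1 ≤ Γ.diam) : f Γ 1 = X := by
  simp [f, hΓ.c_one hD]

theorem c_mul_f_add_two (hΓ : IsDistanceRegular Γ) (hi : i + 2 ≤ Γ.diam) :
    (c Γ (i + 2) : ℝ[X]) * f Γ (i + 2) = X * f Γ (i + 1) - (b Γ i : ℝ[X]) * f Γ i := by
  rw [f, ← mul_assoc, ← C_eq_natCast (c Γ (i + 2)), ← C_mul, mul_inv_cancel₀ (hΓ.c_cast_ne_zero hi),
    C_1, one_mul, C_eq_natCast]

theorem c_add_b_polynomial (hΓ : IsDistanceRegular Γ) (hbip : Γ.IsBipartite) (hi : i ≤ Γ.diam) :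
    (c Γ i : ℝ[X]) + (b Γ i : ℝ[X]) = (b Γ 0 : ℝ[X]) := by
  exact_mod_cast hΓ.c_add_b hbip hi

theorem X_mul_p_succ_sub_b_zero_mul_p (hΓ : IsDistanceRegular Γ) (hbip : Γ.IsBipartite) :
    ∀ i, i + 1 ≤ Γ.diam → X * p Γ (i + 1) - (b Γ 0 : ℝ[X]) * p Γ i =
      X * f Γ (i + 1) - (b Γ i : ℝ[X]) * f Γ i
  | 0, _ => by rw [zero_add, p_one, p_zero, f]
  | 1, hi => by
    have hc := hΓ.c_add_b_polynomial hbip (i := 1) (by omega)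
    rw [hΓ.c_one (by omega), Nat.cast_one] at hc
    rw [p_add_two, p_zero, p_one, hΓ.f_one (by omega)]
    linear_combination X * hc
  | i + 2, hi => by
    have ih := X_mul_p_succ_sub_b_zero_mul_p hΓ hbip i (by omega)
    have hf := hΓ.c_mul_f_add_two (i := i) (by omega)
    have hc := hΓ.c_add_b_polynomial hbip (i := i + 2) (by omega)
    rw [p_add_two, p_add_two i]
    linear_combination ih - hf + f Γ (i + 2) * hc

theorem X_mul_p_succ (hΓ : IsDistanceRegular Γ) (hbip : Γ.IsBipartite) (hi : i + 2 ≤ Γ.diam) :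
    X * p Γ (i + 1) = (c Γ (i + 2) : ℝ[X]) * p Γ (i + 2) + (b Γ (i + 2) : ℝ[X]) * p Γ i := by
  have hp := hΓ.X_mul_p_succ_sub_b_zero_mul_p hbip i (by omega)
  have hf := hΓ.c_mul_f_add_two hi
  have hc := hΓ.c_add_b_polynomial hbip hi
  rw [p_add_two]
  linear_combination hp - hf - p Γ i * hc

theorem eval_p_one (hΓ : IsDistanceRegular Γ) (hD : 1 ≤ Γ.diam) (t : ℝ) :
    (p Γ 1).eval t = t := by
  rw [p_one, hΓ.f_one hD, eval_X]

theorem mul_eval_p_succ (hΓ : IsDistanceRegular Γ) (hbip : Γ.IsBipartite) (hi : i + 2 ≤ Γ.diam)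
    (t : ℝ) : t * (p Γ (i + 1)).eval t =
      c Γ (i + 2) * (p Γ (i + 2)).eval t + b Γ (i + 2) * (p Γ i).eval t := by
  simpa using congrArg (eval t) (hΓ.X_mul_p_succ hbip hi)

theorem X_sq_sub_mul_p (hΓ : IsDistanceRegular Γ) (hbip : Γ.IsBipartite) (hi : Γ.diam = i + 2) :
    (X ^ 2 - (b Γ 0 : ℝ[X]) ^ 2) * p Γ (i + 1) = (b Γ 0 : ℝ[X]) * annihilator Γ := by
  have hp := hΓ.X_mul_p_succ_sub_b_zero_mul_p hbip (i + 1) hi.ge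
  have hD := hΓ.X_mul_p_succ hbip hi.ge
  have hc := hΓ.c_add_b_polynomial hbip hi.ge
  rw [hΓ.b_eq_zero hi.le, Nat.cast_zero] at hD hc
  rw [annihilator, hi, show i + 2 - 1 = i + 1 from rfl]
  linear_combination X * hD + X * p Γ (i + 2) * hc + (b Γ 0 : ℝ[X]) * hp

theorem degree_f (hΓ : IsDistanceRegular Γ) : ∀ i ≤ Γ.diam, (f Γ i).degree = i
  | 0, _ => by simp [f]
  | 1, hi => by rw [hΓ.f_one hi, degree_X, Nat.cast_one]
  | i + 2, hi => by
    rw [f, degree_C_mul (inv_ne_zero (hΓ.c_cast_ne_zero hi)), degree_X_mul_sub_C_mul,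
      degree_f hΓ (i + 1) (by omega)]
    · norm_cast
    · rw [degree_f hΓ (i + 1) (by omega), degree_f hΓ i (by omega)]
      exact_mod_cast (by omega : i < i + 1 + 1)

theorem degree_annihilator (hΓ : IsDistanceRegular Γ) :
    (annihilator Γ).degree = ((Γ.diam + 1 : ℕ) : WithBot ℕ) := by
  rw [annihilator, ← C_eq_natCast, degree_X_mul_sub_C_mul, hΓ.degree_f _ le_rfl]
  · norm_cast
  · rw [hΓ.degree_f _ le_rfl, hΓ.degree_f _ (Nat.sub_le _ _)]
    exact_mod_cast (by omega : Γ.diam - 1 < Γ.diam + 1)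

theorem aeval_annihilator [DecidableEq V] (hΓ : IsDistanceRegular Γ) (hbip : Γ.IsBipartite)
    (hD : 1 ≤ Γ.diam) : aeval (adjacency Γ) (annihilator Γ) = 0 := by
  obtain ⟨i, hi⟩ := Nat.exists_eq_add_of_le' hD
  rw [annihilator, hi, Nat.add_sub_cancel, map_sub, map_mul, map_mul, aeval_X, map_natCast,
    hΓ.aeval_f hbip _ hi.ge, hΓ.aeval_f hbip _ (by omega), hΓ.adjacency_mul_distanceMatrix hbip,
    distanceMatrix_eq_zero hΓ.connected (i := i + 2) (by omega), smul_zero, add_zero,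
    Nat.cast_smul_eq_nsmul, nsmul_eq_mul, sub_self]

end IsDistanceRegular

end Polynomials

section HermitianMatrices

variable {m 𝕜 : Type*} [Fintype m] [DecidableEq m]

theorem aeval_eq_zero_iff_forall_mem_spectrum {A : Type*} [Ring A] [StarRing A]
    [TopologicalSpace A] [Algebra ℝ A] [ContinuousFunctionalCalculus ℝ A IsSelfAdjoint] {a : A}
    (ha : IsSelfAdjoint a) {g : ℝ[X]} :
    Polynomial.aeval a g = 0 ↔ ∀ t ∈ spectrum ℝ a, g.eval t = 0 := by
  rw [← cfc_polynomial g a, ← cfc_zero ℝ a, cfc_eq_cfc_iff_eqOn]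
  rfl

open scoped MatrixOrder in
theorem exists_mem_spectrum_eval_pos [RCLike 𝕜] {A : Matrix m m 𝕜} (hA : IsSelfAdjoint A)
    {g : ℝ[X]} (htrace : (Polynomial.aeval A g).trace = 0) (hg : Polynomial.aeval A g ≠ 0) :
    ∃ t ∈ spectrum ℝ A, 0 < g.eval t := by
  by_contra! hle
  have hnonneg : 0 ≤ Polynomial.aeval A (-g) := by
    rw [← cfc_polynomial (-g) A]
    exact cfc_nonneg fun t ht => by simpa using hle t ht
  rw [Matrix.nonneg_iff_posSemidef, map_neg] at hnonneg
  rw [← neg_ne_zero] at hg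
  exact hg (hnonneg.trace_eq_zero_iff.1 (by rw [Matrix.trace_neg, htrace, neg_zero]))

theorem mem_spectrum_iff_hasEigenvalue_toLin' {R : Type*} [Field R] [Field 𝕜] [Algebra R 𝕜]
    {A : Matrix m m 𝕜} {t : R} :
    t ∈ spectrum R A ↔ Module.End.HasEigenvalue (Matrix.toLin' A) (algebraMap R 𝕜 t) := by
  rw [← spectrum.algebraMap_mem_iff 𝕜, ← Matrix.spectrum_toLin',
    Module.End.hasEigenvalue_iff_mem_spectrum]

theorem mem_spectrum_iff_exists_mulVec_eq_smul {R : Type*} [Field R] [Field 𝕜] [Algebra R 𝕜]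
    {A : Matrix m m 𝕜} {t : R} : t ∈ spectrum R A ↔ ∃ u : m → 𝕜, u ≠ 0 ∧ A *ᵥ u = t • u := by
  rw [mem_spectrum_iff_hasEigenvalue_toLin', Module.End.hasEigenvalue_iff, Submodule.ne_bot_iff]
  simp [and_comm]

end HermitianMatrices

section Spectrum

variable {X : Type*} {Γ : SimpleGraph X}

theorem adjacency_eq_adjMatrix [DecidableRel Γ.Adj] : adjacency Γ = Γ.adjMatrix ℂ := by
  ext y z
  simp [distanceMatrix_apply, SimpleGraph.adjMatrix_apply]

variable [Fintype X]

theorem distanceMatrix_mulVec_apply (i : ℕ) (u : X → ℂ) (y : X) :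
    (distanceMatrix Γ i *ᵥ u) y = ∑ w with Γ.dist y w = i, u w := by
  simp [Matrix.mulVec, dotProduct, distanceMatrix_apply, Finset.sum_filter]

variable [DecidableEq X]

theorem adjacency_pow_apply_eq_zero {m : ℕ} {y z : X} (h : m < Γ.dist y z) :
    (adjacency Γ ^ m) y z = 0 := by
  classical
  rw [adjacency_eq_adjMatrix, SimpleGraph.adjMatrix_pow_apply_eq_card_walk, Nat.cast_eq_zero,
    Fintype.card_eq_zero_iff]
  exact ⟨fun q => h.not_ge (q.2 ▸ SimpleGraph.dist_le q.1)⟩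

theorem adjacency_pow_dist_apply_ne_zero (hc : Γ.Connected) (y z : X) :
    (adjacency Γ ^ Γ.dist y z) y z ≠ 0 := by
  classical
  obtain ⟨q, hq⟩ := hc.exists_walk_length_eq_dist y z
  rw [adjacency_eq_adjMatrix, SimpleGraph.adjMatrix_pow_apply_eq_card_walk, Nat.cast_ne_zero]
  exact (Fintype.card_pos_iff.2 ⟨⟨q, hq⟩⟩).ne'

theorem diam_lt_natDegree_of_aeval_adjacency_eq_zero (hc : Γ.Connected) {g : ℝ[X]} (hg : g ≠ 0)
    (h : Polynomial.aeval (adjacency Γ) g = 0) : Γ.diam < g.natDegree := by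
  by_contra! hle
  obtain ⟨y, z, hyz⟩ := exists_dist_eq hc hle
  have hentry := congrFun (congrFun h y) z
  rw [Polynomial.aeval_eq_sum_range, Matrix.sum_apply, Finset.sum_range_succ,
    Finset.sum_eq_zero, zero_add, Matrix.smul_apply, Matrix.zero_apply, smul_eq_zero, ← hyz]
    at hentry
  · exact hentry.elim (hyz ▸ Polynomial.leadingCoeff_ne_zero.2 hg)
      (adjacency_pow_dist_apply_ne_zero hc y z)
  · intro m hm
    rw [Matrix.smul_apply, adjacency_pow_apply_eq_zero (hyz ▸ Finset.mem_range.1 hm), smul_zero]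

theorem diam_lt_card_spectrum (hc : Γ.Connected) :
    Γ.diam < (Matrix.finite_real_spectrum (A := adjacency Γ)).toFinset.card := by
  set S := (Matrix.finite_real_spectrum (A := adjacency Γ)).toFinset with hS
  rw [← Polynomial.natDegree_finsetProd_X_sub_C_eq_card S id]
  refine diam_lt_natDegree_of_aeval_adjacency_eq_zero hc
    (Polynomial.monic_prod_of_monic _ _ fun t _ => Polynomial.monic_X_sub_C t).ne_zero ?_
  rw [aeval_eq_zero_iff_forall_mem_spectrum (distanceMatrix_isSelfAdjoint 1)]
  intro t ht
  rw [Polynomial.eval_prod]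
  exact Finset.prod_eq_zero (hS ▸ (Set.Finite.mem_toFinset _).2 ht) (by simp)

theorem neg_mem_spectrum_adjacency (hbip : Γ.IsBipartite) {t : ℝ}
    (ht : t ∈ spectrum ℝ (adjacency Γ)) : -t ∈ spectrum ℝ (adjacency Γ) := by
  obtain ⟨u, hu, hAu⟩ := mem_spectrum_iff_exists_mulVec_eq_smul.1 ht
  obtain ⟨C⟩ := hbip
  let ε : X → ℂ := fun y => if C y = 0 then 1 else -1
  have hε (y : X) : ε y ≠ 0 := by dsimp only [ε]; split_ifs <;> simp
  have ε_eq_neg {y w : X} (hyw : Γ.dist y w = 1) : ε w = -ε y := by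
    have hne := C.valid (SimpleGraph.dist_eq_one_iff_adj.1 hyw)
    dsimp only [ε]
    split_ifs <;> first | omega | simp
  refine mem_spectrum_iff_exists_mulVec_eq_smul.2 ⟨ε * u, ?_, funext fun y => ?_⟩
  · obtain ⟨y, hy⟩ := Function.ne_iff.1 hu
    exact Function.ne_iff.2 ⟨y, mul_ne_zero (hε y) hy⟩
  · calc (adjacency Γ *ᵥ (ε * u)) y = ∑ w with Γ.dist y w = 1, -ε y * u w := by
          rw [distanceMatrix_mulVec_apply]
          exact Finset.sum_congr rfl fun w hw => by
            rw [Pi.mul_apply, ε_eq_neg (Finset.mem_filter.1 hw).2]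
      _ = (-t • (ε * u)) y := by
          rw [← Finset.mul_sum, ← distanceMatrix_mulVec_apply, hAu]
          simp [mul_left_comm]

namespace IsDistanceRegular

variable {t : ℝ}

theorem eval_annihilator (hΓ : IsDistanceRegular Γ) (hbip : Γ.IsBipartite) (hD : 1 ≤ Γ.diam)
    (ht : t ∈ spectrum ℝ (adjacency Γ)) : (annihilator Γ).eval t = 0 :=
  (aeval_eq_zero_iff_forall_mem_spectrum (distanceMatrix_isSelfAdjoint 1)).1
    (hΓ.aeval_annihilator hbip hD) t ht

theorem card_spectrum (hΓ : IsDistanceRegular Γ) (hbip : Γ.IsBipartite) (hD : 1 ≤ Γ.diam) :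
    (Matrix.finite_real_spectrum (A := adjacency Γ)).toFinset.card = Γ.diam + 1 := by
  refine le_antisymm ?_ (diam_lt_card_spectrum hΓ.connected)
  rw [← Polynomial.natDegree_eq_of_degree_eq_some hΓ.degree_annihilator]
  refine Polynomial.card_le_degree_of_subset_roots fun t ht => ?_
  have hne : annihilator Γ ≠ 0 := Polynomial.ne_zero_of_coe_le_degree hΓ.degree_annihilator.ge
  exact (Polynomial.mem_roots hne).2
    (hΓ.eval_annihilator hbip hD ((Set.Finite.mem_toFinset _).1 ht))

theorem eval_p_diam_sub_one (hΓ : IsDistanceRegular Γ) (hbip : Γ.IsBipartite) (hD : 2 ≤ Γ.diam)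
    (ht : t ∈ spectrum ℝ (adjacency Γ)) (htk : t ^ 2 ≠ (b Γ 0 : ℝ) ^ 2) :
    (p Γ (Γ.diam - 1)).eval t = 0 := by
  obtain ⟨i, hi⟩ := Nat.exists_eq_add_of_le' hD
  have h := congrArg (Polynomial.eval t) (hΓ.X_sq_sub_mul_p hbip hi)
  simp only [Polynomial.eval_mul, Polynomial.eval_sub, Polynomial.eval_pow, Polynomial.eval_X,
    Polynomial.eval_natCast, hΓ.eval_annihilator hbip (by omega) ht, mul_zero] at h
  rw [hi]
  exact (mul_eq_zero.1 h).resolve_left (sub_ne_zero.2 htk)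

theorem b_zero_mem_spectrum (hΓ : IsDistanceRegular Γ) :
    (b Γ 0 : ℝ) ∈ spectrum ℝ (adjacency Γ) := by
  have := hΓ.connected.nonempty
  refine mem_spectrum_iff_exists_mulVec_eq_smul.2 ⟨1, one_ne_zero, funext fun y => ?_⟩
  rw [distanceMatrix_mulVec_apply]
  simp [hΓ.card_neighbors y]

theorem abs_le_b_zero (hΓ : IsDistanceRegular Γ) (ht : t ∈ spectrum ℝ (adjacency Γ)) :
    |t| ≤ b Γ 0 := by
  obtain ⟨y, hy⟩ := eigenvalue_mem_ball (mem_spectrum_iff_hasEigenvalue_toLin'.1 ht)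
  have hdiag : adjacency Γ y y = 0 := by simp [distanceMatrix_apply]
  rw [hdiag, mem_closedBall_zero_iff, norm_algebraMap', Real.norm_eq_abs] at hy
  calc |t| ≤ ∑ w ∈ Finset.univ.erase y, ‖adjacency Γ y w‖ := hy
    _ ≤ ∑ w, ‖adjacency Γ y w‖ := Finset.sum_le_univ_sum_of_nonneg fun _ => norm_nonneg _
    _ = b Γ 0 := by
      rw [← hΓ.card_neighbors y]
      simp [distanceMatrix_apply, apply_ite norm]

end IsDistanceRegular

end Spectrum

section Traces

variable {X : Type*} [Fintype X] {Γ : SimpleGraph X}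

theorem trace_distanceMatrix_mul_distanceMatrix {i j : ℕ} (hij : i ≠ j) :
    (distanceMatrix Γ i * distanceMatrix Γ j).trace = 0 := by
  refine Finset.sum_eq_zero fun y _ => ?_
  rw [Matrix.diag_apply, distanceMatrix_mul_distanceMatrix_apply, Nat.cast_eq_zero,
    sphereCount, Finset.card_eq_zero, Finset.filter_eq_empty_iff]
  rintro w - ⟨rfl, hwy⟩
  exact hij (Γ.dist_comm.trans hwy)

theorem trace_distanceMatrix_succ (i : ℕ) : (distanceMatrix Γ (i + 1)).trace = 0 := by
  simp [Matrix.trace, distanceMatrix_apply]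

variable [DecidableEq X]

namespace IsDistanceRegular

theorem adjacency_sq (hΓ : IsDistanceRegular Γ) (hbip : Γ.IsBipartite) :
    adjacency Γ ^ 2 = (b Γ 0 : ℝ) • 1 + (c Γ 2 : ℝ) • distanceMatrix Γ 2 := by
  rw [sq, hΓ.adjacency_mul_distanceMatrix hbip, distanceMatrix_zero hΓ.connected]

theorem trace_adjacency_sq (hΓ : IsDistanceRegular Γ) (hbip : Γ.IsBipartite) :
    (adjacency Γ ^ 2).trace = b Γ 0 * Fintype.card X := by
  rw [hΓ.adjacency_sq hbip, Matrix.trace_add, Matrix.trace_smul, Matrix.trace_smul,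
    trace_distanceMatrix_succ]
  simp

theorem trace_adjacency_pow_four (hΓ : IsDistanceRegular Γ) (hbip : Γ.IsBipartite) :
    (adjacency Γ ^ 4).trace = (b Γ 0 + c Γ 2 * b Γ 1) * (adjacency Γ ^ 2).trace := by
  have hcube : adjacency Γ ^ 3 = (b Γ 0 + c Γ 2 * b Γ 1 : ℝ) • adjacency Γ +
      (c Γ 2 * c Γ 3 : ℝ) • distanceMatrix Γ 3 := by
    rw [pow_succ', hΓ.adjacency_sq hbip, mul_add, Matrix.mul_smul, Matrix.mul_smul, mul_one,
      hΓ.adjacency_mul_distanceMatrix hbip]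
    module
  rw [pow_succ', hcube, mul_add, Matrix.mul_smul, Matrix.mul_smul, Matrix.trace_add,
    Matrix.trace_smul, Matrix.trace_smul,
    trace_distanceMatrix_mul_distanceMatrix (i := 1) (j := 3) (by omega), ← sq]
  simp

theorem trace_aeval_sq_sub_mul_sq_sub (hΓ : IsDistanceRegular Γ) (hbip : Γ.IsBipartite)
    (hD : 2 ≤ Γ.diam) :
    (Polynomial.aeval (adjacency Γ) ((Polynomial.X ^ 2 - (b Γ 0 : ℝ[X]) ^ 2) *
      (Polynomial.X ^ 2 - (b Γ 2 : ℝ[X])))).trace = 0 := by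
  have hb₁ : (1 + b Γ 1 : ℂ) = b Γ 0 := by
    exact_mod_cast hΓ.c_one (by omega) ▸ hΓ.c_add_b hbip (i := 1) (by omega)
  have hb₂ : (c Γ 2 + b Γ 2 : ℂ) = b Γ 0 := by exact_mod_cast hΓ.c_add_b hbip hD
  have expand : (adjacency Γ ^ 2 - (b Γ 0 : Matrix X X ℂ) ^ 2) *
      (adjacency Γ ^ 2 - (b Γ 2 : Matrix X X ℂ)) = adjacency Γ ^ 4 -
        (b Γ 0 ^ 2 + b Γ 2 : ℂ) • adjacency Γ ^ 2 + (b Γ 0 ^ 2 * b Γ 2 : ℂ) • 1 := by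
    simp only [Algebra.smul_def, map_mul, map_add, map_pow,
      map_natCast]
    rw [mul_sub, sub_mul, sub_mul, ← Nat.cast_comm]
    noncomm_ring
  simp only [map_mul, map_sub, map_pow, Polynomial.aeval_X, map_natCast]
  rw [expand, Matrix.trace_add, Matrix.trace_sub, Matrix.trace_smul, Matrix.trace_smul,
    hΓ.trace_adjacency_pow_four hbip, hΓ.trace_adjacency_sq hbip, Matrix.trace_one, smul_eq_mul,
    smul_eq_mul]
  linear_combination (b Γ 0 : ℂ) * Fintype.card X * (b Γ 1 * hb₂ + (b Γ 0 - b Γ 2 : ℂ) * hb₁)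

theorem exists_mem_spectrum_of_sq_sub (hΓ : IsDistanceRegular Γ) (hbip : Γ.IsBipartite)
    (hD : 4 ≤ Γ.diam) :
    (∃ t ∈ spectrum ℝ (adjacency Γ), (b Γ 2 : ℝ) < t ^ 2 ∧ t ^ 2 < (b Γ 0 : ℝ) ^ 2) ∧
      ∃ t ∈ spectrum ℝ (adjacency Γ), t ^ 2 < b Γ 2 := by
  set g : ℝ[X] := (Polynomial.X ^ 2 - (b Γ 0 : ℝ[X]) ^ 2) * (Polynomial.X ^ 2 - (b Γ 2 : ℝ[X]))
    with hg
  have eval_g (t : ℝ) : g.eval t = (t ^ 2 - (b Γ 0 : ℝ) ^ 2) * (t ^ 2 - b Γ 2) := by simp [hg]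
  have htrace : (Polynomial.aeval (adjacency Γ) g).trace = 0 :=
    hΓ.trace_aeval_sq_sub_mul_sq_sub hbip (by omega)
  have hdegree : g.natDegree = 4 := by rw [hg]; compute_degree!
  have hg₀ : g ≠ 0 := Polynomial.ne_zero_of_natDegree_gt (n := 3) (by omega)
  have haeval : Polynomial.aeval (adjacency Γ) g ≠ 0 := fun h =>
    (hdegree ▸ diam_lt_natDegree_of_aeval_adjacency_eq_zero hΓ.connected hg₀ h).not_ge hD
  have sq_le {t : ℝ} (ht : t ∈ spectrum ℝ (adjacency Γ)) : t ^ 2 ≤ (b Γ 0 : ℝ) ^ 2 :=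
    sq_le_sq.2 ((hΓ.abs_le_b_zero ht).trans (le_abs_self _))
  constructor
  · obtain ⟨t, ht, hpos⟩ := exists_mem_spectrum_eval_pos (A := adjacency Γ) (g := -g)
      (distanceMatrix_isSelfAdjoint 1) (by rw [map_neg, Matrix.trace_neg, htrace, neg_zero])
      (by rwa [map_neg, neg_ne_zero])
    rw [Polynomial.eval_neg, eval_g] at hpos
    have := sq_le ht
    exact ⟨t, ht, by nlinarith, by nlinarith⟩
  · obtain ⟨t, ht, hpos⟩ :=
      exists_mem_spectrum_eval_pos (distanceMatrix_isSelfAdjoint 1) htrace haeval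
    rw [eval_g] at hpos
    have := sq_le ht
    exact ⟨t, ht, by nlinarith⟩

end IsDistanceRegular

end Traces

section OrderedEigenvalues

variable {X : Type*} [Fintype X] [DecidableEq X] {Γ : SimpleGraph X}

namespace IsDistanceRegular

theorem strictAntiOn_eigenvalue (hΓ : IsDistanceRegular Γ) (hbip : Γ.IsBipartite)
    (hD : 1 ≤ Γ.diam) : StrictAntiOn (eigenvalue Γ) (Set.Iic Γ.diam) := by
  intro i hi j hj hij
  have hlength := (Finset.length_sort (fun s t : ℝ => s ≥ t)).trans (hΓ.card_spectrum hbip hD)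
  rw [Set.mem_Iic, ← Nat.lt_add_one_iff, ← hlength] at hi hj
  rw [eigenvalue, eigenvalue, List.getD_eq_getElem _ _ hi, List.getD_eq_getElem _ _ hj]
  exact List.pairwise_iff_getElem.1 (Finset.sortedGT_sort _).pairwise i j hi hj hij

theorem mem_spectrum_iff_exists_eigenvalue_eq (hΓ : IsDistanceRegular Γ) (hbip : Γ.IsBipartite)
    (hD : 1 ≤ Γ.diam) {t : ℝ} :
    t ∈ spectrum ℝ (adjacency Γ) ↔ ∃ i ≤ Γ.diam, eigenvalue Γ i = t := by
  have hlength := (Finset.length_sort (fun s t : ℝ => s ≥ t)).trans (hΓ.card_spectrum hbip hD)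
  rw [← (Matrix.finite_real_spectrum (A := adjacency Γ)).mem_toFinset,
    ← Finset.mem_sort (fun s t : ℝ => s ≥ t), List.mem_iff_getElem]
  simp only [← Nat.lt_add_one_iff, ← hlength]
  exact exists_congr fun i => ⟨fun ⟨hi, h⟩ => ⟨hi, (List.getD_eq_getElem _ _ hi).trans h⟩,
    fun ⟨hi, h⟩ => ⟨hi, (List.getD_eq_getElem _ _ hi).symm.trans h⟩⟩

theorem eigenvalue_mem_spectrum (hΓ : IsDistanceRegular Γ) (hbip : Γ.IsBipartite)
    (hD : 1 ≤ Γ.diam) {i : ℕ} (hi : i ≤ Γ.diam) : eigenvalue Γ i ∈ spectrum ℝ (adjacency Γ) :=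
  (hΓ.mem_spectrum_iff_exists_eigenvalue_eq hbip hD).2 ⟨i, hi, rfl⟩

theorem eigenvalue_diam_sub (hΓ : IsDistanceRegular Γ) (hbip : Γ.IsBipartite)
    (hD : 1 ≤ Γ.diam) {i : ℕ} (hi : i ≤ Γ.diam) :
    eigenvalue Γ (Γ.diam - i) = -eigenvalue Γ i := by
  let increasing : Fin (Γ.diam + 1) → ℝ := fun j => eigenvalue Γ (Γ.diam - j)
  let negated : Fin (Γ.diam + 1) → ℝ := fun j => -eigenvalue Γ j
  have hanti := hΓ.strictAntiOn_eigenvalue hbip hD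
  have hincreasing : StrictMono increasing := fun j l hjl =>
    hanti (Nat.sub_le _ _) (Nat.sub_le _ _) (by have := l.is_lt; omega)
  have hnegated : StrictMono negated := fun j l hjl =>
    neg_lt_neg (hanti (Nat.lt_succ_iff.1 j.is_lt) (Nat.lt_succ_iff.1 l.is_lt) hjl)
  have hrange : Set.range increasing = Set.range negated := by
    have range_iff {t : ℝ} := hΓ.mem_spectrum_iff_exists_eigenvalue_eq hbip hD (t := t)
    ext t
    constructor
    · rintro ⟨j, rfl⟩
      obtain ⟨l, hl, h⟩ := range_iff.1 (neg_mem_spectrum_adjacency hbip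
        (hΓ.eigenvalue_mem_spectrum hbip hD (Nat.sub_le Γ.diam j)))
      exact ⟨⟨l, Nat.lt_succ_iff.2 hl⟩, neg_eq_iff_eq_neg.2 h⟩
    · rintro ⟨j, rfl⟩
      obtain ⟨l, hl, h⟩ := range_iff.1 (neg_mem_spectrum_adjacency hbip
        (hΓ.eigenvalue_mem_spectrum hbip hD (Nat.lt_succ_iff.1 j.is_lt)))
      exact ⟨⟨Γ.diam - l, by omega⟩, by simpa only [increasing, Nat.sub_sub_self hl] using h⟩
  exact congrFun ((hincreasing.range_inj hnegated).1 hrange) ⟨i, Nat.lt_succ_iff.2 hi⟩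

theorem eigenvalue_zero (hΓ : IsDistanceRegular Γ) (hbip : Γ.IsBipartite) (hD : 1 ≤ Γ.diam) :
    eigenvalue Γ 0 = b Γ 0 := by
  obtain ⟨i, hi, h⟩ :=
    (hΓ.mem_spectrum_iff_exists_eigenvalue_eq hbip hD).1 hΓ.b_zero_mem_spectrum
  refine le_antisymm ((le_abs_self _).trans
    (hΓ.abs_le_b_zero (hΓ.eigenvalue_mem_spectrum hbip hD (Nat.zero_le _)))) (h ▸ ?_)
  exact (hΓ.strictAntiOn_eigenvalue hbip hD).antitoneOn (Nat.zero_le _) hi (Nat.zero_le i)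

theorem eigenvalue_pos (hΓ : IsDistanceRegular Γ) (hbip : Γ.IsBipartite) {i : ℕ}
    (hi : 2 * i < Γ.diam) : 0 < eigenvalue Γ i := by
  have hneg := hΓ.eigenvalue_diam_sub hbip (by omega) (i := i) (by omega)
  have hlt : eigenvalue Γ (Γ.diam - i) < eigenvalue Γ i :=
    hΓ.strictAntiOn_eigenvalue hbip (by omega) (show i ≤ Γ.diam by omega) (Nat.sub_le _ _)
      (by omega)
  linarith

theorem eigenvalue_sq_lt (hΓ : IsDistanceRegular Γ) (hbip : Γ.IsBipartite) {i : ℕ}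
    (hi₀ : 0 < i) (hi : 2 * i < Γ.diam) : eigenvalue Γ i ^ 2 < (b Γ 0 : ℝ) ^ 2 := by
  rw [← hΓ.eigenvalue_zero hbip (by omega)]
  exact pow_lt_pow_left₀ (hΓ.strictAntiOn_eigenvalue hbip (by omega) (Nat.zero_le _)
    (show i ≤ Γ.diam by omega) hi₀) (hΓ.eigenvalue_pos hbip hi).le two_ne_zero

theorem b_two_lt_eigenvalue_one_sq (hΓ : IsDistanceRegular Γ) (hbip : Γ.IsBipartite)
    (hD : 4 ≤ Γ.diam) : (b Γ 2 : ℝ) < eigenvalue Γ 1 ^ 2 := by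
  obtain ⟨⟨t, ht, hlt, htk⟩, -⟩ := hΓ.exists_mem_spectrum_of_sq_sub hbip hD
  obtain ⟨i, hi, rfl⟩ := (hΓ.mem_spectrum_iff_exists_eigenvalue_eq hbip (by omega)).1 ht
  have hanti := (hΓ.strictAntiOn_eigenvalue hbip (by omega)).antitoneOn
  have hi₀ : i ≠ 0 := by
    rintro rfl
    exact htk.ne (by rw [hΓ.eigenvalue_zero hbip (by omega)])
  have hiD : i ≠ Γ.diam := by
    rintro rfl
    have := hΓ.eigenvalue_diam_sub hbip (by omega) (Nat.zero_le _)
    exact htk.ne (by rw [← Nat.sub_zero Γ.diam, this, hΓ.eigenvalue_zero hbip (by omega), neg_sq])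
  refine hlt.trans_le (sq_le_sq' ?_ ?_)
  · rw [← hΓ.eigenvalue_diam_sub hbip (by omega) (by omega)]
    exact hanti hi (Nat.sub_le _ _) (by omega)
  · exact hanti (show 1 ≤ Γ.diam by omega) hi (by omega)

theorem eigenvalue_sq_lt_b_two (hΓ : IsDistanceRegular Γ) (hbip : Γ.IsBipartite)
    (hD : 4 ≤ Γ.diam) {i : ℕ} (hi : Γ.diam = 2 * i + 1) : eigenvalue Γ i ^ 2 < b Γ 2 := by
  obtain ⟨-, t, ht, hlt⟩ := hΓ.exists_mem_spectrum_of_sq_sub hbip hD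
  obtain ⟨j, hj, rfl⟩ := (hΓ.mem_spectrum_iff_exists_eigenvalue_eq hbip (by omega)).1 ht
  have hanti := (hΓ.strictAntiOn_eigenvalue hbip (by omega)).antitoneOn
  refine (sq_le_sq.2 ?_).trans_lt hlt
  rw [abs_of_pos (hΓ.eigenvalue_pos hbip (by omega)), le_abs]
  rcases Nat.lt_or_ge i j with hij | hij
  · right
    rw [le_neg, ← hΓ.eigenvalue_diam_sub hbip (by omega) (by omega)]
    exact hanti (Nat.sub_le _ _) hj (by omega)
  · exact Or.inl (hanti hj (show i ≤ Γ.diam by omega) hij)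

theorem eigenvalue_sq_ne_b_two (hΓ : IsDistanceRegular Γ) (hbip : Γ.IsBipartite)
    (hD : 4 ≤ Γ.diam) {n : ℕ} (hn : n = 1 ∨ (Odd Γ.diam ∧ n = Γ.diam / 2)) :
    eigenvalue Γ n ^ 2 ≠ b Γ 2 := by
  rcases hn with rfl | ⟨hodd, rfl⟩
  · exact (hΓ.b_two_lt_eigenvalue_one_sq hbip hD).ne'
  · exact (hΓ.eigenvalue_sq_lt_b_two hbip hD (Nat.two_mul_div_two_add_one_of_odd hodd).symm).ne

end IsDistanceRegular

end OrderedEigenvalues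

section DualIdempotents

variable {X : Type*} [DecidableEq X] {Γ : SimpleGraph X} {x : X}

theorem dualIdempotent_isHermitian (x : X) (i : ℕ) : (dualIdempotent Γ x i).IsHermitian :=
  Matrix.isHermitian_diagonal_of_self_adjoint _ <| funext fun y => by simp [apply_ite star]

variable [Fintype X] {i j : ℕ} {u : X → ℂ}

theorem dualIdempotent_mulVec_apply (x : X) (i : ℕ) (u : X → ℂ) (y : X) :
    (dualIdempotent Γ x i *ᵥ u) y = if Γ.dist x y = i then u y else 0 := by
  rw [dualIdempotent, Matrix.mulVec_diagonal, ite_mul, one_mul, zero_mul]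

theorem dualIdempotent_mulVec_eq_self (hu : ∀ y, u y ≠ 0 → Γ.dist x y = i) :
    dualIdempotent Γ x i *ᵥ u = u := by
  ext y
  rw [dualIdempotent_mulVec_apply, ite_eq_left_iff]
  exact fun hy => (not_not.1 (mt (hu y) hy)).symm

theorem dualIdempotent_mulVec_eq_zero (hij : i ≠ j) (hu : ∀ y, u y ≠ 0 → Γ.dist x y = j) :
    dualIdempotent Γ x i *ᵥ u = 0 := by
  ext y
  rw [dualIdempotent_mulVec_apply, Pi.zero_apply, ite_eq_right_iff]
  exact fun hy => not_not.1 (mt (hu y) (hy ▸ hij))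

theorem dualIdempotent_mulVec_adjacency_mulVec (hc : Γ.Connected) (hbip : Γ.IsBipartite) (x : X)
    (i : ℕ) (u : X → ℂ) : dualIdempotent Γ x (i + 1) *ᵥ (adjacency Γ *ᵥ u) =
      dualIdempotent Γ x (i + 1) *ᵥ (adjacency Γ *ᵥ (dualIdempotent Γ x i *ᵥ u)) +
      dualIdempotent Γ x (i + 1) *ᵥ (adjacency Γ *ᵥ (dualIdempotent Γ x (i + 2) *ᵥ u)) := by
  ext y
  simp only [Pi.add_apply, dualIdempotent_mulVec_apply,
    distanceMatrix_mulVec_apply]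
  split_ifs with hy
  · rw [← Finset.sum_add_distrib]
    refine Finset.sum_congr rfl fun w hw => ?_
    have hyw := SimpleGraph.dist_eq_one_iff_adj.1 (Finset.mem_filter.1 hw).2
    rcases dist_eq_add_one_or_dist_eq_add_one hc hbip hyw x with h | h
    · simp [show Γ.dist x w = i + 2 by omega]
    · simp [show Γ.dist x w = i by omega]
  · rw [add_zero]

theorem adjacency_mulVec_eq_add (hc : Γ.Connected) (hbip : Γ.IsBipartite)
    (hu : ∀ y, u y ≠ 0 → Γ.dist x y = i + 1) : adjacency Γ *ᵥ u =
      dualIdempotent Γ x (i + 2) *ᵥ (adjacency Γ *ᵥ u) +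
      dualIdempotent Γ x i *ᵥ (adjacency Γ *ᵥ u) := by
  ext y
  rw [Pi.add_apply, dualIdempotent_mulVec_apply, dualIdempotent_mulVec_apply]
  by_cases hy : (adjacency Γ *ᵥ u) y = 0
  · simp [hy]
  · rw [distanceMatrix_mulVec_apply] at hy
    obtain ⟨w, hw, huw⟩ := Finset.exists_ne_zero_of_sum_ne_zero hy
    have hyw := SimpleGraph.dist_eq_one_iff_adj.1 (Finset.mem_filter.1 hw).2
    have hxw := hu w huw
    rcases dist_eq_add_one_or_dist_eq_add_one hc hbip hyw x with h | h
    · simp [show Γ.dist x y = i by omega]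
    · simp [show Γ.dist x y = i + 2 by omega]

theorem star_dotProduct_dualIdempotent_mulVec_adjacency_mulVec {u' : X → ℂ}
    (hu : ∀ y, u y ≠ 0 → Γ.dist x y = i) (hu' : ∀ y, u' y ≠ 0 → Γ.dist x y = j) :
    star u ⬝ᵥ (dualIdempotent Γ x i *ᵥ (adjacency Γ *ᵥ u')) =
      star (dualIdempotent Γ x j *ᵥ (adjacency Γ *ᵥ u)) ⬝ᵥ u' := by
  have adjoint {M : Matrix X X ℂ} (hM : M.IsHermitian) (a a' : X → ℂ) :
      star a ⬝ᵥ (M *ᵥ a') = star (M *ᵥ a) ⬝ᵥ a' := by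
    rw [Matrix.star_mulVec, hM.eq, Matrix.dotProduct_mulVec]
  rw [adjoint (dualIdempotent_isHermitian x i), dualIdempotent_mulVec_eq_self hu,
    adjoint (distanceMatrix_isSelfAdjoint 1), ← adjoint (dualIdempotent_isHermitian x j),
    dualIdempotent_mulVec_eq_self hu']

end DualIdempotents

section Modules

variable {X : Type*} [Fintype X] [DecidableEq X] {Γ : SimpleGraph X} {x : X}
  {W : Submodule ℂ (X → ℂ)} {i : ℕ} {u : X → ℂ}

theorem dualIdempotent_mem_subconstituentAlgebra (i : ℕ) :
    dualIdempotent Γ x i ∈ subconstituentAlgebra Γ x :=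
  Algebra.subset_adjoin (Set.mem_insert_of_mem _ (Set.mem_range_self i))

theorem isTModule_of_forall_mulVec_mem (hA : ∀ w ∈ W, adjacency Γ *ᵥ w ∈ W)
    (hE : ∀ i, ∀ w ∈ W, dualIdempotent Γ x i *ᵥ w ∈ W) : IsTModule Γ x W := by
  intro B hB
  induction hB using Algebra.adjoin_induction with
  | mem B hB =>
    rcases hB with rfl | ⟨i, rfl⟩
    exacts [hA, hE i]
  | algebraMap r =>
    intro w hw
    rw [Algebra.algebraMap_eq_smul_one, Matrix.smul_mulVec, Matrix.one_mulVec]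
    exact W.smul_mem _ hw
  | add B C _ _ hB hC =>
    intro w hw
    rw [Matrix.add_mulVec]
    exact W.add_mem (hB w hw) (hC w hw)
  | mul B C _ _ hB hC =>
    intro w hw
    rw [← Matrix.mulVec_mulVec]
    exact hB _ (hC w hw)

theorem isTModule_span {S : Set (X → ℂ)} (hA : ∀ u ∈ S, adjacency Γ *ᵥ u ∈ Submodule.span ℂ S)
    (hE : ∀ i, ∀ u ∈ S, dualIdempotent Γ x i *ᵥ u ∈ Submodule.span ℂ S) :
    IsTModule Γ x (Submodule.span ℂ S) := by
  have stable {B : Matrix X X ℂ} (hB : ∀ u ∈ S, B *ᵥ u ∈ Submodule.span ℂ S) :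
      Submodule.span ℂ S ≤ (Submodule.span ℂ S).comap B.mulVecLin := Submodule.span_le.2 hB
  exact isTModule_of_forall_mulVec_mem (stable hA) fun i => stable (hE i)

theorem mem_of_mem_dualComponent (hW : IsTModule Γ x W) (hu : u ∈ dualComponent Γ x W i) :
    u ∈ W := by
  obtain ⟨w, hw, rfl⟩ := hu
  exact hW _ (dualIdempotent_mem_subconstituentAlgebra i) w hw

theorem dist_eq_of_mem_dualComponent (hu : u ∈ dualComponent Γ x W i) (y : X) (hy : u y ≠ 0) :
    Γ.dist x y = i := by
  obtain ⟨w, -, rfl⟩ := hu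
  rw [Matrix.mulVecLin_apply, dualIdempotent_mulVec_apply] at hy
  exact (ite_ne_right_iff.1 hy).1

theorem dualComponent_eq_bot_of_lt_endpoint (h : i < endpoint Γ x W) (hi : i ≤ Γ.diam) :
    dualComponent Γ x W i = ⊥ :=
  not_not.1 fun hne => Nat.notMem_of_lt_sInf h ⟨hi, hne⟩

theorem IsThin.exists_smul_eq (hthin : IsThin Γ x W) (hi : i ≤ Γ.diam) {u' : X → ℂ}
    (hu : u ∈ dualComponent Γ x W i) (hu₀ : u ≠ 0) (hu' : u' ∈ dualComponent Γ x W i) :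
    ∃ a : ℂ, a • u = u' := by
  have hu₀' : (⟨u, hu⟩ : dualComponent Γ x W i) ≠ 0 := fun h => hu₀ (congrArg Subtype.val h)
  have hfinrank := (hthin i hi).antisymm (Module.finrank_pos_iff_exists_ne_zero.2 ⟨_, hu₀'⟩)
  obtain ⟨a, ha⟩ := (finrank_eq_one_iff_of_nonzero' _ hu₀').1 hfinrank ⟨u', hu'⟩
  exact ⟨a, congrArg Subtype.val ha⟩

end Modules

section LocalVectors

variable {X : Type*} [Fintype X] [DecidableEq X] {Γ : SimpleGraph X} {x : X} {v : X → ℂ}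

/-- The vector `E*_i A_j v`. For `v` in `E*_2 W`, the vectors `E*_{i+2} A_i v` turn out to be the
basis of `W`. -/
noncomputable def localVector (Γ : SimpleGraph X) (x : X) (v : X → ℂ) (i j : ℕ) : X → ℂ :=
  (dualIdempotent Γ x i * distanceMatrix Γ j) *ᵥ v

theorem localVector_eq (i j : ℕ) :
    localVector Γ x v i j = dualIdempotent Γ x i *ᵥ (distanceMatrix Γ j *ᵥ v) :=
  (Matrix.mulVec_mulVec _ _ _).symm

theorem localVector_apply (i j : ℕ) (y : X) : localVector Γ x v i j y =
    if Γ.dist x y = i then ∑ w with Γ.dist y w = j, v w else 0 := by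
  rw [localVector_eq, dualIdempotent_mulVec_apply, distanceMatrix_mulVec_apply]

theorem dist_eq_of_localVector_ne_zero {i j : ℕ} (y : X) (hy : localVector Γ x v i j y ≠ 0) :
    Γ.dist x y = i := by
  rw [localVector_apply] at hy
  exact (ite_ne_right_iff.1 hy).1

theorem localVector_zero_right (hc : Γ.Connected) {i : ℕ} (hv : ∀ w, v w ≠ 0 → Γ.dist x w = i) :
    localVector Γ x v i 0 = v := by
  rw [localVector_eq, distanceMatrix_zero hc, Matrix.one_mulVec, dualIdempotent_mulVec_eq_self hv]

theorem localVector_eq_zero (hc : Γ.Connected) {i j m : ℕ} (hv : ∀ w, v w ≠ 0 → Γ.dist x w = m)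
    (h : j + m < i ∨ i + m < j) : localVector Γ x v i j = 0 := by
  ext y
  rw [localVector_apply, Pi.zero_apply, ite_eq_right_iff]
  refine fun hy => Finset.sum_eq_zero fun w hw => ?_
  by_contra hne
  have hxw := hv w hne
  have hyw := (Finset.mem_filter.1 hw).2
  have hxy := hc.dist_triangle (u := x) (v := w) (w := y)
  have hyw' := hc.dist_triangle (u := y) (v := x) (w := w)
  rw [Γ.dist_comm (u := w) (v := y)] at hxy
  rw [Γ.dist_comm (u := y) (v := x)] at hyw'
  omega

namespace IsDistanceRegular

theorem dualIdempotent_mulVec_adjacency_mulVec_localVector_add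
    (hΓ : IsDistanceRegular Γ) (hbip : Γ.IsBipartite) (i j : ℕ) :
    dualIdempotent Γ x (i + 1) *ᵥ (adjacency Γ *ᵥ localVector Γ x v i (j + 1)) +
      dualIdempotent Γ x (i + 1) *ᵥ (adjacency Γ *ᵥ localVector Γ x v (i + 2) (j + 1)) =
    (b Γ j : ℝ) • localVector Γ x v (i + 1) j +
      (c Γ (j + 2) : ℝ) • localVector Γ x v (i + 1) (j + 2) := by
  simp only [localVector_eq]
  rw [← dualIdempotent_mulVec_adjacency_mulVec hΓ.connected hbip,
    Matrix.mulVec_mulVec _ (adjacency Γ), hΓ.adjacency_mul_distanceMatrix hbip, Matrix.add_mulVec,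
    Matrix.smul_mulVec, Matrix.smul_mulVec, Matrix.mulVec_add, Matrix.mulVec_smul,
    Matrix.mulVec_smul]

theorem dualIdempotent_mulVec_adjacency_mulVec_localVector (hΓ : IsDistanceRegular Γ)
    (hbip : Γ.IsBipartite) (hv : ∀ w, v w ≠ 0 → Γ.dist x w = 2) (hD : 1 ≤ Γ.diam) (r : ℕ) :
    dualIdempotent Γ x (r + 3) *ᵥ (adjacency Γ *ᵥ localVector Γ x v (r + 2) r) =
      (c Γ (r + 1) : ℝ) • localVector Γ x v (r + 3) (r + 1) := by
  rcases r with _ | r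
  · rw [localVector_zero_right hΓ.connected hv, localVector_eq, hΓ.c_one hD, Nat.cast_one,
      one_smul]
  · have h := hΓ.dualIdempotent_mulVec_adjacency_mulVec_localVector_add hbip
      (x := x) (v := v) (r + 3) r
    rwa [localVector_eq_zero (i := r + 5) (j := r + 1) hΓ.connected hv (by omega),
      localVector_eq_zero (i := r + 4) (j := r) hΓ.connected hv (by omega), smul_zero,
      Matrix.mulVec_zero, Matrix.mulVec_zero, zero_add, add_zero] at h

theorem dualIdempotent_mulVec_adjacency_mulVec_localVector_add_five
    (hΓ : IsDistanceRegular Γ) (hbip : Γ.IsBipartite) (hv : ∀ w, v w ≠ 0 → Γ.dist x w = 2)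
    (r : ℕ) :
    dualIdempotent Γ x (r + 2) *ᵥ (adjacency Γ *ᵥ localVector Γ x v (r + 3) (r + 5)) =
      (b Γ (r + 4) : ℝ) • localVector Γ x v (r + 2) (r + 4) := by
  have h := hΓ.dualIdempotent_mulVec_adjacency_mulVec_localVector_add hbip
    (x := x) (v := v) (r + 1) (r + 4)
  rwa [localVector_eq_zero (i := r + 1) (j := r + 5) hΓ.connected hv (by omega),
    localVector_eq_zero (i := r + 2) (j := r + 6) hΓ.connected hv (by omega), smul_zero,
    Matrix.mulVec_zero, Matrix.mulVec_zero, zero_add, add_zero] at h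

open scoped ComplexOrder in
theorem localVector_eq_zero_of_dualIdempotent_mulVec_eq_zero (hΓ : IsDistanceRegular Γ)
    (hbip : Γ.IsBipartite) (hv : ∀ w, v w ≠ 0 → Γ.dist x w = 2) {r : ℕ} (hr : r + 1 ≤ Γ.diam)
    (h : dualIdempotent Γ x (r + 2) *ᵥ (adjacency Γ *ᵥ localVector Γ x v (r + 3) (r + 1)) = 0) :
    localVector Γ x v (r + 3) (r + 1) = 0 := by
  have hdot := star_dotProduct_dualIdempotent_mulVec_adjacency_mulVec (Γ := Γ) (x := x)
    (u := localVector Γ x v (r + 3) (r + 1)) (u' := localVector Γ x v (r + 2) r)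
    dist_eq_of_localVector_ne_zero dist_eq_of_localVector_ne_zero
  rw [hΓ.dualIdempotent_mulVec_adjacency_mulVec_localVector hbip hv (by omega), h, star_zero,
    zero_dotProduct, dotProduct_smul, smul_eq_zero, dotProduct_star_self_eq_zero] at hdot
  exact hdot.resolve_left (hΓ.c_cast_ne_zero hr)

end IsDistanceRegular

/-- The vectors supported at distance `2` from `x` that `E*_1 A` annihilates, such as those of
`E*_2 W` for a `T`-module `W` of endpoint `2`. -/
structure IsEndpointTwoVector (Γ : SimpleGraph X) (x : X) (v : X → ℂ) : Prop where
  dist_eq : ∀ w, v w ≠ 0 → Γ.dist x w = 2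
  localVector_one_one : localVector Γ x v 1 1 = 0

namespace IsEndpointTwoVector

theorem sum_eq_zero (hv : IsEndpointTwoVector Γ x v) (hΓ : IsDistanceRegular Γ)
    (hbip : Γ.IsBipartite) (hD : 2 ≤ Γ.diam) : ∑ w, v w = 0 := by
  have hsq : (adjacency Γ *ᵥ (adjacency Γ *ᵥ v)) x = 0 := by
    rw [distanceMatrix_mulVec_apply]
    refine Finset.sum_eq_zero fun y hy => ?_
    have hy₀ := congrFun hv.localVector_one_one y
    rwa [localVector_eq, dualIdempotent_mulVec_apply, if_pos (Finset.mem_filter.1 hy).2] at hy₀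
  have hx : v x = 0 := not_not.1 fun h => by simpa using hv.dist_eq x h
  have hsphere : (distanceMatrix Γ 2 *ᵥ v) x = ∑ w, v w := by
    rw [distanceMatrix_mulVec_apply]
    exact Finset.sum_filter_of_ne fun w _ => hv.dist_eq w
  rw [Matrix.mulVec_mulVec, hΓ.adjacency_mul_distanceMatrix hbip 0, Matrix.add_mulVec,
    Matrix.smul_mulVec, Matrix.smul_mulVec, distanceMatrix_zero hΓ.connected, Matrix.one_mulVec,
    Pi.add_apply, Pi.smul_apply, Pi.smul_apply, hx, smul_zero, zero_add, hsphere] at hsq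
  exact (smul_eq_zero.1 hsq).resolve_left (hΓ.c_cast_ne_zero hD)

theorem localVector_add_add (hv : IsEndpointTwoVector Γ x v) (hΓ : IsDistanceRegular Γ)
    (hbip : Γ.IsBipartite) (hD : 2 ≤ Γ.diam) (r : ℕ) :
    localVector Γ x v (r + 2) r + localVector Γ x v (r + 2) (r + 2) +
      localVector Γ x v (r + 2) (r + 4) = 0 := by
  ext y
  simp only [Pi.add_apply, localVector_apply, Pi.zero_apply]
  split_ifs with hy
  · rw [← hv.sum_eq_zero hΓ hbip hD, Finset.sum_filter, Finset.sum_filter, Finset.sum_filter,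
      ← Finset.sum_add_distrib, ← Finset.sum_add_distrib]
    refine Finset.sum_congr rfl fun w _ => ?_
    rcases eq_or_ne (v w) 0 with hw | hw
    · simp [hw]
    have hxw := hv.dist_eq w hw
    have hxy := hΓ.connected.dist_triangle (u := x) (v := w) (w := y)
    have hyw := hΓ.connected.dist_triangle (u := y) (v := x) (w := w)
    have hparity := even_dist_add_dist_add_dist hΓ.connected hbip x y w
    rw [Γ.dist_comm (u := w) (v := y)] at hxy
    rw [Γ.dist_comm (u := y) (v := x)] at hyw
    rw [Nat.even_iff] at hparity
    have hcases : Γ.dist y w = r ∨ Γ.dist y w = r + 2 ∨ Γ.dist y w = r + 4 := by omega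
    rcases hcases with h | h | h <;> simp [h]
  · simp

end IsEndpointTwoVector

end LocalVectors

section Coefficients

variable {X : Type*} [Fintype X] {Γ : SimpleGraph X} {t : ℝ} {r : ℕ}

/-- The scalar `α_r` with `E*_{r+2} A_{r+4} v = -α_r E*_{r+2} A_r v`. Its value for `r = 0` is
dictated by the local eigenvalue, and then for larger `r` by `localRatio_succ_mul_omega`. -/
noncomputable def localRatio (Γ : SimpleGraph X) (t : ℝ) (r : ℕ) : ℝ :=
  -((b Γ (r + 2) : ℝ) * b Γ (r + 3) / (c Γ (r + 1) * c Γ (r + 2)) *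
    ((p Γ r).eval t / (p Γ (r + 2)).eval t))

-- The junk value `x / c_0 = x / 0 = 0`.
theorem omega_zero (Γ : SimpleGraph X) (t : ℝ) : omega Γ t 0 = 0 := by
  simp [omega, c]

theorem omega_succ_eq_zero (h : (p Γ (r + 3)).eval t = 0) : omega Γ t (r + 1) = 0 := by
  simp [omega, h]

namespace IsDistanceRegular

theorem eval_p_two (hΓ : IsDistanceRegular Γ) (hbip : Γ.IsBipartite) (hD : 2 ≤ Γ.diam) (t : ℝ) :
    (p Γ 2).eval t = (t ^ 2 - b Γ 2) / c Γ 2 := by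
  have hrec := hΓ.mul_eval_p_succ hbip (i := 0) hD t
  rw [zero_add, zero_add, hΓ.eval_p_one (by omega), p_zero, Polynomial.eval_one, mul_one] at hrec
  rw [eq_div_iff (hΓ.c_cast_ne_zero hD)]
  linear_combination -hrec

theorem one_add_tilde (hΓ : IsDistanceRegular Γ) (hbip : Γ.IsBipartite) (hD : 2 ≤ Γ.diam)
    (ht : t ^ 2 ≠ b Γ 2) : 1 + tilde Γ t = localRatio Γ t 0 := by
  have hc₂ := hΓ.c_cast_ne_zero (i := 1) hD
  have ht' := sub_ne_zero.2 ht
  simp only [localRatio, tilde, zero_add, hΓ.eval_p_two hbip hD, p_zero, Polynomial.eval_one,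
    hΓ.c_one (by omega), Nat.cast_one]
  field_simp
  ring

theorem omega_one (hΓ : IsDistanceRegular Γ) (hbip : Γ.IsBipartite) (hD : 3 ≤ Γ.diam)
    (hp₁ : (p Γ 1).eval t ≠ 0) (hp₂ : (p Γ 2).eval t ≠ 0) :
    omega Γ t 1 = b Γ 0 + c Γ 2 * (localRatio Γ t 0 - 1) := by
  have hrec := hΓ.mul_eval_p_succ hbip (i := 1) hD t
  have hk := hΓ.c_add_b_cast hbip (i := 2) (by omega)
  have hc₂ := hΓ.c_cast_ne_zero (i := 1) (by omega)
  rw [hΓ.eval_p_one (by omega)] at hp₁ hrec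
  simp only [Nat.reduceAdd] at hrec
  simp only [omega, localRatio, Nat.sub_self, p_zero, hΓ.eval_p_one (by omega : 1 ≤ Γ.diam) t,
    hΓ.c_one (by omega), Nat.cast_one, Polynomial.eval_one, Nat.reduceAdd, zero_add]
  field_simp
  linear_combination t * (p Γ 2).eval t * hk - (b Γ 2 : ℝ) * hrec

theorem omega_add_two (hΓ : IsDistanceRegular Γ) (hbip : Γ.IsBipartite) (hr : r + 4 ≤ Γ.diam)
    (hp₂ : (p Γ (r + 2)).eval t ≠ 0) (hp₃ : (p Γ (r + 3)).eval t ≠ 0) :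
    omega Γ t (r + 2) = b Γ (r + 1) + c Γ (r + 3) * (localRatio Γ t (r + 1) - 1) -
      c Γ (r + 1) * (localRatio Γ t r - 1) := by
  have hrec := hΓ.mul_eval_p_succ hbip (i := r) (by omega) t
  have hrec' := hΓ.mul_eval_p_succ hbip (i := r + 2) hr t
  have hk := hΓ.c_add_b_cast hbip (i := r + 1) (by omega)
  have hk' := hΓ.c_add_b_cast hbip (i := r + 3) (by omega)
  have hc₁ := hΓ.c_cast_ne_zero (i := r) (by omega)
  have hc₂ := hΓ.c_cast_ne_zero (i := r + 1) (by omega)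
  have hc₃ := hΓ.c_cast_ne_zero (i := r + 2) (by omega)
  simp only [add_assoc, Nat.reduceAdd] at hrec' hc₂ hc₃
  simp only [omega, localRatio, add_assoc, Nat.reduceAdd, Nat.reduceSubDiff]
  field_simp
  linear_combination
    (b Γ (r + 3) : ℝ) * ((p Γ (r + 3)).eval t * hrec - (p Γ (r + 1)).eval t * hrec') +
      c Γ (r + 2) * (p Γ (r + 2)).eval t * (p Γ (r + 3)).eval t * (hk' - hk)

theorem localRatio_succ_mul_omega (hΓ : IsDistanceRegular Γ) (hr : r + 3 ≤ Γ.diam)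
    (hp : ∀ j ≤ r + 3, (p Γ j).eval t ≠ 0) :
    localRatio Γ t (r + 1) * omega Γ t (r + 1) = b Γ (r + 4) * localRatio Γ t r := by
  have hp₀ := hp r (by omega)
  have hp₁ := hp (r + 1) (by omega)
  have hp₂ := hp (r + 2) (by omega)
  have hp₃ := hp (r + 3) le_rfl
  have hc₁ := hΓ.c_cast_ne_zero (i := r) (by omega)
  have hc₂ := hΓ.c_cast_ne_zero (i := r + 1) (by omega)
  have hc₃ := hΓ.c_cast_ne_zero (i := r + 2) (by omega)
  simp only [add_assoc, Nat.reduceAdd] at hc₂ hc₃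
  simp only [omega, localRatio, add_assoc, Nat.reduceAdd, Nat.add_sub_cancel]
  field_simp

theorem localRatio_ne_zero (hΓ : IsDistanceRegular Γ) (hr : r + 4 ≤ Γ.diam)
    (hp₀ : (p Γ r).eval t ≠ 0) (hp₂ : (p Γ (r + 2)).eval t ≠ 0) : localRatio Γ t r ≠ 0 := by
  have hb₂ := hΓ.b_cast_ne_zero (i := r + 2) (by omega)
  have hb₃ := hΓ.b_cast_ne_zero (i := r + 3) (by omega)
  have hc₁ := hΓ.c_cast_ne_zero (i := r) (by omega)
  have hc₂ := hΓ.c_cast_ne_zero (i := r + 1) (by omega)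
  exact neg_ne_zero.2 (mul_ne_zero (div_ne_zero (mul_ne_zero hb₂ hb₃) (mul_ne_zero hc₁ hc₂))
    (div_ne_zero hp₀ hp₂))

end IsDistanceRegular

end Coefficients

section ThinModules

variable {X : Type*} [Fintype X] [DecidableEq X] {Γ : SimpleGraph X} {x : X} {v : X → ℂ}
  {W : Submodule ℂ (X → ℂ)} {t : ℝ} {m : ℕ}

theorem localVector_mem_dualComponent (hΓ : IsDistanceRegular Γ) (hbip : Γ.IsBipartite)
    (hW : IsTModule Γ x W) (hv : v ∈ W) (i j : ℕ) :
    localVector Γ x v i j ∈ dualComponent Γ x W i := by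
  rw [localVector_eq]
  exact ⟨_, hW _ (hΓ.distanceMatrix_mem_subconstituentAlgebra hbip x j) v hv, rfl⟩

theorem isEndpointTwoVector_of_mem_dualComponent (hΓ : IsDistanceRegular Γ)
    (hbip : Γ.IsBipartite) (hD : 1 ≤ Γ.diam) (hW : IsTModule Γ x W) (hend : endpoint Γ x W = 2)
    (hv : v ∈ dualComponent Γ x W 2) : IsEndpointTwoVector Γ x v where
  dist_eq := dist_eq_of_mem_dualComponent hv
  localVector_one_one := by
    have hmem := localVector_mem_dualComponent hΓ hbip hW (mem_of_mem_dualComponent hW hv) 1 1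
    rwa [dualComponent_eq_bot_of_lt_endpoint (by omega) hD, Submodule.mem_bot] at hmem

theorem HasLocalEigenvalue.localVector_two_two {η : ℝ} (hη : HasLocalEigenvalue Γ x W η)
    (hv : v ∈ dualComponent Γ x W 2) : localVector Γ x v 2 2 = (η : ℂ) • v := by
  rw [← hη.2 v hv, ← Matrix.mulVec_mulVec,
    dualIdempotent_mulVec_eq_self (dist_eq_of_mem_dualComponent hv), localVector]

theorem linearIndependent_localVector {N : ℕ}
    (h : ∀ i : Fin N, localVector Γ x v (i + 2) i ≠ 0) :
    LinearIndependent ℂ fun i : Fin N => localVector Γ x v (i + 2) i := by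
  rw [Fintype.linearIndependent_iff]
  intro g hg i
  have hgi := congrArg (dualIdempotent Γ x (i + 2) *ᵥ ·) hg
  simp only [Matrix.mulVec_sum, Matrix.mulVec_smul, Matrix.mulVec_zero] at hgi
  rw [Finset.sum_eq_single i, dualIdempotent_mulVec_eq_self dist_eq_of_localVector_ne_zero] at hgi
  · exact (smul_eq_zero.1 hgi).resolve_right (h i)
  · intro j _ hj
    rw [dualIdempotent_mulVec_eq_zero (by omega) dist_eq_of_localVector_ne_zero, smul_zero]
  · exact fun hi => absurd (Finset.mem_univ i) hi

theorem eq_zero_of_mem_span_localVector {i N : ℕ} (hi : N + 1 < i) {u : X → ℂ}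
    (hu : ∀ y, u y ≠ 0 → Γ.dist x y = i)
    (hmem : u ∈ Submodule.span ℂ (Set.range fun j : Fin N => localVector Γ x v (j + 2) j)) :
    u = 0 := by
  have hle : Submodule.span ℂ (Set.range fun j : Fin N => localVector Γ x v (j + 2) j) ≤
      LinearMap.ker (dualIdempotent Γ x i).mulVecLin := by
    refine Submodule.span_le.2 ?_
    rintro _ ⟨j, rfl⟩
    exact dualIdempotent_mulVec_eq_zero (by omega) dist_eq_of_localVector_ne_zero
  rw [← dualIdempotent_mulVec_eq_self hu]
  exact hle hmem

/-- The structure that a thin module of endpoint `2` and local eigenvalue `tilde Γ t` imposes on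
its components `E*_2 W, …, E*_{m+2} W`; it is established by induction on `m`. -/
structure HasLocalRatios (Γ : SimpleGraph X) (x : X) (v : X → ℂ) (t : ℝ) (m : ℕ) : Prop where
  localVector_ne_zero : ∀ j ≤ m, localVector Γ x v (j + 2) j ≠ 0
  localVector_add_four : ∀ j ≤ m,
    localVector Γ x v (j + 2) (j + 4) = -localRatio Γ t j • localVector Γ x v (j + 2) j
  eval_p_ne_zero : ∀ j ≤ m + 2, (p Γ j).eval t ≠ 0

theorem hasLocalRatios_zero (hΓ : IsDistanceRegular Γ) (hbip : Γ.IsBipartite) (hD : 2 ≤ Γ.diam)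
    (hv : IsEndpointTwoVector Γ x v) (hv₀ : v ≠ 0) (ht : t ≠ 0) (htb : t ^ 2 ≠ b Γ 2)
    (hη : localVector Γ x v 2 2 = (tilde Γ t : ℂ) • v) : HasLocalRatios Γ x v t 0 where
  localVector_ne_zero j hj := by
    obtain rfl := Nat.le_zero.1 hj
    rwa [localVector_zero_right hΓ.connected hv.dist_eq]
  localVector_add_four j hj := by
    obtain rfl := Nat.le_zero.1 hj
    have hadd := hv.localVector_add_add hΓ hbip hD 0
    simp only [zero_add, hη, localVector_zero_right hΓ.connected hv.dist_eq,
      ← hΓ.one_add_tilde hbip hD htb, Complex.coe_smul] at hadd ⊢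
    rw [← sub_eq_zero, ← hadd]
    module
  eval_p_ne_zero j hj := by
    interval_cases j
    · simp [p_zero]
    · rwa [hΓ.eval_p_one (by omega)]
    · rw [hΓ.eval_p_two hbip hD]
      exact div_ne_zero (sub_ne_zero.2 htb) (hΓ.c_cast_ne_zero hD)

namespace HasLocalRatios

theorem localVector_add_two (h : HasLocalRatios Γ x v t m) (hΓ : IsDistanceRegular Γ)
    (hbip : Γ.IsBipartite) (hD : 2 ≤ Γ.diam) (hv : IsEndpointTwoVector Γ x v) {j : ℕ}
    (hj : j ≤ m) : localVector Γ x v (j + 2) (j + 2) =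
      (localRatio Γ t j - 1) • localVector Γ x v (j + 2) j := by
  have hadd := hv.localVector_add_add hΓ hbip hD j
  rw [h.localVector_add_four j hj] at hadd
  rw [← sub_eq_zero, ← hadd]
  module

theorem dualIdempotent_mulVec_adjacency_mulVec_localVector_succ (h : HasLocalRatios Γ x v t m)
    (hΓ : IsDistanceRegular Γ) (hbip : Γ.IsBipartite) (hv : IsEndpointTwoVector Γ x v) {j : ℕ}
    (hj : j ≤ m) (hjD : j + 3 ≤ Γ.diam) :
    dualIdempotent Γ x (j + 2) *ᵥ (adjacency Γ *ᵥ localVector Γ x v (j + 3) (j + 1)) =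
      omega Γ t (j + 1) • localVector Γ x v (j + 2) j := by
  have hD : 2 ≤ Γ.diam := by omega
  rcases j with _ | j
  · have hsum := hΓ.dualIdempotent_mulVec_adjacency_mulVec_localVector_add hbip
      (x := x) (v := v) 1 0
    rw [hv.localVector_one_one, Matrix.mulVec_zero, Matrix.mulVec_zero, zero_add,
      h.localVector_add_two hΓ hbip hD hv hj] at hsum
    rw [hΓ.omega_one hbip hjD (h.eval_p_ne_zero 1 (by omega)) (h.eval_p_ne_zero 2 (by omega)),
      hsum]
    module
  · have hsum := hΓ.dualIdempotent_mulVec_adjacency_mulVec_localVector_add hbip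
      (x := x) (v := v) (j + 2) (j + 1)
    rw [h.localVector_add_two hΓ hbip hD hv (by omega), Matrix.mulVec_smul, Matrix.mulVec_smul,
      hΓ.dualIdempotent_mulVec_adjacency_mulVec_localVector hbip hv.dist_eq (by omega),
      h.localVector_add_two hΓ hbip hD hv hj] at hsum
    rw [hΓ.omega_add_two hbip (by omega) (h.eval_p_ne_zero _ (by omega))
      (h.eval_p_ne_zero _ (by omega)), eq_sub_of_add_eq' hsum]
    module

-- For `r = 0` the last term vanishes because `omega Γ t 0 = 0`.
theorem adjacency_mulVec_localVector (h : HasLocalRatios Γ x v t m) (hΓ : IsDistanceRegular Γ)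
    (hbip : Γ.IsBipartite) (hv : IsEndpointTwoVector Γ x v) {r : ℕ} (hr : r ≤ m + 1)
    (hrD : r + 2 ≤ Γ.diam) : adjacency Γ *ᵥ localVector Γ x v (r + 2) r =
      (c Γ (r + 1) : ℝ) • localVector Γ x v (r + 3) (r + 1) +
        omega Γ t r • localVector Γ x v (r - 1 + 2) (r - 1) := by
  rw [adjacency_mulVec_eq_add hΓ.connected hbip dist_eq_of_localVector_ne_zero,
    hΓ.dualIdempotent_mulVec_adjacency_mulVec_localVector hbip hv.dist_eq (by omega)]
  rcases r with _ | r
  · rw [omega_zero, zero_smul, localVector_zero_right hΓ.connected hv.dist_eq, ← localVector_eq,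
      hv.localVector_one_one]
  · rw [h.dualIdempotent_mulVec_adjacency_mulVec_localVector_succ hΓ hbip hv (by omega) (by omega),
      Nat.add_sub_cancel]

theorem isTModule_span_localVector (h : HasLocalRatios Γ x v t m) (hΓ : IsDistanceRegular Γ)
    (hbip : Γ.IsBipartite) (hv : IsEndpointTwoVector Γ x v) (hmD : m + 2 ≤ Γ.diam)
    (hlast : localVector Γ x v (m + 3) (m + 1) = 0) :
    IsTModule Γ x
      (Submodule.span ℂ (Set.range fun j : Fin (m + 1) => localVector Γ x v (j + 2) j)) := by
  set S := Submodule.span ℂ (Set.range fun j : Fin (m + 1) => localVector Γ x v (j + 2) j)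
  have localVector_mem (r : ℕ) (hr : r ≤ m + 1) : localVector Γ x v (r + 2) r ∈ S := by
    rcases hr.eq_or_lt with rfl | hr
    · exact hlast ▸ S.zero_mem
    · exact Submodule.subset_span ⟨⟨r, hr⟩, rfl⟩
  refine isTModule_span ?_ fun i => ?_
  · rintro _ ⟨⟨r, hr⟩, rfl⟩
    rw [h.adjacency_mulVec_localVector hΓ hbip hv (by omega) (by omega)]
    exact S.add_mem (S.smul_of_tower_mem _ (localVector_mem (r + 1) (by omega)))
      (S.smul_of_tower_mem _ (localVector_mem (r - 1) (by omega)))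
  · rintro _ ⟨⟨r, hr⟩, rfl⟩
    rcases eq_or_ne i (r + 2) with rfl | hi
    · rw [dualIdempotent_mulVec_eq_self dist_eq_of_localVector_ne_zero]
      exact localVector_mem r (by omega)
    · rw [dualIdempotent_mulVec_eq_zero hi dist_eq_of_localVector_ne_zero]
      exact S.zero_mem

theorem span_localVector_eq (h : HasLocalRatios Γ x v t m) (hΓ : IsDistanceRegular Γ)
    (hbip : Γ.IsBipartite) (hv : IsEndpointTwoVector Γ x v) (hW : IsIrreducibleTModule Γ x W)
    (hvW : v ∈ W) (hmD : m + 2 ≤ Γ.diam) (hlast : localVector Γ x v (m + 3) (m + 1) = 0) :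
    Submodule.span ℂ (Set.range fun j : Fin (m + 1) => localVector Γ x v (j + 2) j) = W := by
  refine (hW.eq_bot_or_eq _ (Submodule.span_le.2 ?_)
    (h.isTModule_span_localVector hΓ hbip hv hmD hlast)).resolve_left fun hbot => ?_
  · rintro _ ⟨j, rfl⟩
    exact mem_of_mem_dualComponent hW.isTModule
      (localVector_mem_dualComponent hΓ hbip hW.isTModule hvW _ _)
  · exact h.localVector_ne_zero 0 (Nat.zero_le m)
      ((Submodule.span_eq_bot.1 hbot) _ ⟨0, rfl⟩)

theorem localVector_succ_ne_zero (h : HasLocalRatios Γ x v t m) (hΓ : IsDistanceRegular Γ)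
    (hbip : Γ.IsBipartite) (hv : IsEndpointTwoVector Γ x v) (hW : IsIrreducibleTModule Γ x W)
    (hvW : v ∈ W) (hmD : m + 5 ≤ Γ.diam) : localVector Γ x v (m + 3) (m + 1) ≠ 0 := by
  intro hlast
  have hfar : localVector Γ x v (m + 3) (m + 5) = 0 := by
    refine eq_zero_of_mem_span_localVector (v := v) (N := m + 1) (by omega)
      dist_eq_of_localVector_ne_zero ?_
    rw [h.span_localVector_eq hΓ hbip hv hW hvW (by omega) hlast]
    exact mem_of_mem_dualComponent hW.isTModule
      (localVector_mem_dualComponent hΓ hbip hW.isTModule hvW _ _)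
  have hlower :=
    hΓ.dualIdempotent_mulVec_adjacency_mulVec_localVector_add_five hbip hv.dist_eq m
  rw [hfar, Matrix.mulVec_zero, Matrix.mulVec_zero, h.localVector_add_four m le_rfl] at hlower
  have hα := hΓ.localRatio_ne_zero (by omega) (h.eval_p_ne_zero m (by omega))
    (h.eval_p_ne_zero (m + 2) le_rfl)
  exact smul_ne_zero (hΓ.b_cast_ne_zero (by omega))
    (smul_ne_zero (neg_ne_zero.2 hα) (h.localVector_ne_zero m le_rfl)) hlower.symm

theorem exists_localVector_eq_smul (h : HasLocalRatios Γ x v t m) (hΓ : IsDistanceRegular Γ)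
    (hbip : Γ.IsBipartite) (hv : IsEndpointTwoVector Γ x v) (hW : IsIrreducibleTModule Γ x W)
    (hthin : IsThin Γ x W) (hvW : v ∈ W) (hmD : m + 5 ≤ Γ.diam) :
    ∃ a : ℂ, localVector Γ x v (m + 3) (m + 5) = a • localVector Γ x v (m + 3) (m + 1) ∧
      a * omega Γ t (m + 1) = ((-(b Γ (m + 4) * localRatio Γ t m) : ℝ) : ℂ) := by
  have hmem := localVector_mem_dualComponent hΓ hbip hW.isTModule hvW (m + 3)
  obtain ⟨a, ha⟩ := hthin.exists_smul_eq (by omega) (hmem (m + 1))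
    (h.localVector_succ_ne_zero hΓ hbip hv hW hvW hmD) (hmem (m + 5))
  refine ⟨a, ha.symm, smul_left_injective ℂ (h.localVector_ne_zero m le_rfl) ?_⟩
  have hlower :=
    hΓ.dualIdempotent_mulVec_adjacency_mulVec_localVector_add_five hbip hv.dist_eq m
  rw [← ha, Matrix.mulVec_smul, Matrix.mulVec_smul, h.localVector_add_four m le_rfl,
    h.dualIdempotent_mulVec_adjacency_mulVec_localVector_succ hΓ hbip hv le_rfl (by omega),
    smul_smul, mul_neg] at hlower
  simpa only [mul_smul, Complex.coe_smul] using hlower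

theorem succ (h : HasLocalRatios Γ x v t m) (hΓ : IsDistanceRegular Γ) (hbip : Γ.IsBipartite)
    (hv : IsEndpointTwoVector Γ x v) (hW : IsIrreducibleTModule Γ x W) (hthin : IsThin Γ x W)
    (hvW : v ∈ W) (hmD : m + 5 ≤ Γ.diam) : HasLocalRatios Γ x v t (m + 1) := by
  obtain ⟨a, ha, haω⟩ := h.exists_localVector_eq_smul hΓ hbip hv hW hthin hvW hmD
  have hω : omega Γ t (m + 1) ≠ 0 := by
    intro hω
    rw [hω, Complex.ofReal_zero, mul_zero, eq_comm, Complex.ofReal_eq_zero, neg_eq_zero] at haω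
    exact mul_ne_zero (hΓ.b_cast_ne_zero hmD) (hΓ.localRatio_ne_zero (by omega)
      (h.eval_p_ne_zero m (by omega)) (h.eval_p_ne_zero (m + 2) le_rfl)) haω
  have hp (j : ℕ) (hj : j ≤ m + 3) : (p Γ j).eval t ≠ 0 := by
    rcases hj.eq_or_lt with rfl | hj
    · exact mt omega_succ_eq_zero hω
    · exact h.eval_p_ne_zero j (by omega)
  have haα : a = ((-localRatio Γ t (m + 1) : ℝ) : ℂ) := by
    refine mul_right_cancel₀ (Complex.ofReal_ne_zero.2 hω) (haω.trans ?_)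
    rw [← hΓ.localRatio_succ_mul_omega (by omega) hp, ← neg_mul, Complex.ofReal_mul]
  refine ⟨fun j hj => ?_, fun j hj => ?_, hp⟩
  · rcases hj.eq_or_lt with rfl | hj
    · exact h.localVector_succ_ne_zero hΓ hbip hv hW hvW hmD
    · exact h.localVector_ne_zero j (by omega)
  · rcases hj.eq_or_lt with rfl | hj
    · rw [ha, haα, Complex.coe_smul]
    · exact h.localVector_add_four j (by omega)

theorem localVector_succ_eq_zero (h : HasLocalRatios Γ x v t m) (hΓ : IsDistanceRegular Γ)
    (hbip : Γ.IsBipartite) (hv : IsEndpointTwoVector Γ x v) (hmD : m + 3 ≤ Γ.diam)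
    (hp : (p Γ (m + 3)).eval t = 0) : localVector Γ x v (m + 3) (m + 1) = 0 := by
  refine hΓ.localVector_eq_zero_of_dualIdempotent_mulVec_eq_zero hbip hv.dist_eq (by omega) ?_
  rw [h.dualIdempotent_mulVec_adjacency_mulVec_localVector_succ hΓ hbip hv le_rfl hmD,
    omega_succ_eq_zero hp, zero_smul]

theorem exists_basis (h : HasLocalRatios Γ x v t m) (hΓ : IsDistanceRegular Γ)
    (hbip : Γ.IsBipartite) (hv : IsEndpointTwoVector Γ x v) (hW : IsIrreducibleTModule Γ x W)
    (hvW : v ∈ W) (hmD : m + 2 ≤ Γ.diam) (hlast : localVector Γ x v (m + 3) (m + 1) = 0) :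
    ∃ B : Module.Basis (Fin (m + 1)) ℂ W, ∀ i, (B i : X → ℂ) = localVector Γ x v (i + 2) i := by
  have hli : LinearIndependent ℂ fun i : Fin (m + 1) => localVector Γ x v (i + 2) i :=
    linearIndependent_localVector fun i => h.localVector_ne_zero i (by omega)
  refine ⟨(Module.Basis.span hli).map
    (LinearEquiv.ofEq _ _ (h.span_localVector_eq hΓ hbip hv hW hvW hmD hlast)), fun i => ?_⟩
  rw [Module.Basis.map_apply, LinearEquiv.coe_ofEq_apply, Module.Basis.span_apply]

end HasLocalRatios

theorem hasLocalRatios (hΓ : IsDistanceRegular Γ) (hbip : Γ.IsBipartite)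
    (hv : IsEndpointTwoVector Γ x v) (hv₀ : v ≠ 0) (hvW : v ∈ W)
    (hW : IsIrreducibleTModule Γ x W) (hthin : IsThin Γ x W) (ht : t ≠ 0) (htb : t ^ 2 ≠ b Γ 2)
    (hη : localVector Γ x v 2 2 = (tilde Γ t : ℂ) • v) (hm : m + 4 ≤ Γ.diam) :
    HasLocalRatios Γ x v t m := by
  induction m with
  | zero => exact hasLocalRatios_zero hΓ hbip (by omega) hv hv₀ ht htb hη
  | succ m ih => exact (ih (by omega)).succ hΓ hbip hv hW hthin hvW (by omega)

end ThinModules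

section TridiagonalAction

variable {X : Type*} [Fintype X] {Γ : SimpleGraph X} {t : ℝ}

theorem sum_tridiagonal_smul {M : Type*} [AddCommGroup M] [Module ℂ M] {u : ℕ → M}
    (hlast : u (Γ.diam - 3) = 0) (s : Fin (Γ.diam - 3)) :
    ∑ r, tridiagonal Γ t r s • u r =
      (c Γ (s + 1) : ℂ) • u (s + 1) + (omega Γ t s : ℂ) • u (s - 1) := by
  have hsplit (r : Fin (Γ.diam - 3)) : tridiagonal Γ t r s • u r =
      (if (r : ℕ) = s + 1 then (c Γ r : ℂ) • u r else 0) +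
        (if (s : ℕ) = r + 1 then (omega Γ t s : ℂ) • u r else 0) := by
    simp only [tridiagonal, Matrix.of_apply]
    split_ifs <;> first | omega | simp
  have hlower : ∑ r : Fin (Γ.diam - 3), (if (r : ℕ) = s + 1 then (c Γ r : ℂ) • u r else 0) =
      (c Γ (s + 1) : ℂ) • u (s + 1) := by
    rcases (Nat.succ_le_of_lt s.is_lt).lt_or_eq with hs | hs
    · rw [Finset.sum_eq_single ⟨s + 1, hs⟩ (fun r _ hr => if_neg (mt Fin.ext hr))
        (fun h => absurd (Finset.mem_univ _) h), if_pos rfl]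
    · rw [Nat.succ_eq_add_one] at hs
      rw [Finset.sum_eq_zero fun r _ => if_neg (by omega), hs, hlast, smul_zero]
  have hupper : ∑ r : Fin (Γ.diam - 3), (if (s : ℕ) = r + 1 then (omega Γ t s : ℂ) • u r else 0) =
      (omega Γ t s : ℂ) • u (s - 1) := by
    rcases Nat.eq_zero_or_pos (s : ℕ) with hs | hs
    · rw [Finset.sum_eq_zero fun r _ => if_neg (by omega), hs, omega_zero, Complex.ofReal_zero,
        zero_smul]
    · rw [Finset.sum_eq_single ⟨s - 1, by omega⟩
        (fun r _ hr => if_neg fun h => hr (Fin.ext (by simp [h])))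
        (fun h => absurd (Finset.mem_univ _) h), if_pos (by dsimp only; omega)]
  rw [Finset.sum_congr rfl fun r _ => hsplit r, Finset.sum_add_distrib, hlower, hupper]

theorem toMatrix_adjacencyOn_eq_tridiagonal [DecidableEq X] {x : X} {W : Submodule ℂ (X → ℂ)}
    (hW : IsTModule Γ x W) {u : ℕ → X → ℂ} (hlast : u (Γ.diam - 3) = 0)
    (hu : ∀ r < Γ.diam - 3, adjacency Γ *ᵥ u r =
      (c Γ (r + 1) : ℝ) • u (r + 1) + omega Γ t r • u (r - 1))
    (B : Module.Basis (Fin (Γ.diam - 3)) ℂ W) (hB : ∀ i, (B i : X → ℂ) = u i) :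
    LinearMap.toMatrix B B (adjacencyOn Γ x W hW) = tridiagonal Γ t := by
  refine (LinearEquiv.eq_symm_apply (LinearMap.toMatrix B B)).1 (B.ext fun s => Subtype.ext ?_)
  have hcoe : (adjacencyOn Γ x W hW (B s) : X → ℂ) = adjacency Γ *ᵥ u s := by
    rw [← hB]
    rfl
  rw [LinearMap.toMatrix_symm, Matrix.toLin_self, Submodule.coe_sum, hcoe, hu s s.is_lt]
  simp only [Submodule.coe_smul, hB, sum_tridiagonal_smul hlast, ← Complex.coe_smul,
    Complex.ofReal_natCast]

end TridiagonalAction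

end DRG

open DRG in
theorem mainTheorem9_general {X : Type*} [Fintype X] [DecidableEq X] (Γ : SimpleGraph X)
    (hΓ : IsDistanceRegular Γ) (hbip : Γ.IsBipartite) (hD : 4 ≤ Γ.diam) (x : X) (t : ℝ)
    (ht : t ∈ spectrum ℝ (adjacency Γ)) (ht₀ : t ≠ 0) (htk : t ^ 2 ≠ (b Γ 0 : ℝ) ^ 2)
    (htb : t ^ 2 ≠ b Γ 2) (W : Submodule ℂ (X → ℂ)) (hW : IsIrreducibleTModule Γ x W)
    (hthin : IsThin Γ x W) (hend : endpoint Γ x W = 2)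
    (hη : HasLocalEigenvalue Γ x W (tilde Γ t)) (v : X → ℂ) (hv : v ∈ dualComponent Γ x W 2)
    (hv₀ : v ≠ 0) :
    (∀ i : ℕ, 1 ≤ i → i ≤ Γ.diam - 4 →
      c Γ i ≠ 0 ∧ (p Γ i).eval t ≠ 0 ∧ (p Γ (i + 1)).eval t ≠ 0) ∧
    ∃ B : Module.Basis (Fin (Γ.diam - 3)) ℂ W,
      (∀ i : Fin (Γ.diam - 3), (B i : X → ℂ) =
        (dualIdempotent Γ x ((i : ℕ) + 2) * distanceMatrix Γ i) *ᵥ v) ∧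
      LinearMap.toMatrix B B (adjacencyOn Γ x W hW.isTModule) = tridiagonal Γ t := by
  obtain ⟨m, hm⟩ := Nat.exists_eq_add_of_le' hD
  have hvW := mem_of_mem_dualComponent hW.isTModule hv
  have hv₂ := isEndpointTwoVector_of_mem_dualComponent hΓ hbip (by omega) hW.isTModule hend hv
  have hratios := hasLocalRatios hΓ hbip hv₂ hv₀ hvW hW hthin ht₀ htb
    (hη.localVector_two_two hv) hm.ge
  have hroot := hΓ.eval_p_diam_sub_one hbip (by omega) ht htk
  rw [show Γ.diam - 1 = m + 3 by omega] at hroot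
  have hlast := hratios.localVector_succ_eq_zero hΓ hbip hv₂ (by omega) hroot
  have hlen : Γ.diam - 3 = m + 1 := by omega
  obtain ⟨B, hB⟩ : ∃ B : Module.Basis (Fin (Γ.diam - 3)) ℂ W,
      ∀ i, (B i : X → ℂ) = localVector Γ x v (i + 2) i := by
    rw [hlen]
    exact hratios.exists_basis hΓ hbip hv₂ hW hvW (by omega) hlast
  refine ⟨fun i hi hi' => ⟨?_, hratios.eval_p_ne_zero i (by omega),
    hratios.eval_p_ne_zero (i + 1) (by omega)⟩, B, hB, ?_⟩
  · obtain ⟨j, rfl⟩ := Nat.exists_eq_add_of_le' hi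
    exact (hΓ.c_pos (by omega)).ne'
  · exact toMatrix_adjacencyOn_eq_tridiagonal hW.isTModule
      (u := fun r => localVector Γ x v (r + 2) r) (by rwa [hlen])
      (fun r hr => hratios.adjacency_mulVec_localVector hΓ hbip hv₂ (by omega) (by omega)) B hB

theorem mainTheorem9 {X : Type*} [Fintype X] [DecidableEq X] (Γ : SimpleGraph X)
    (hΓ : DRG.IsDistanceRegular Γ) (hbip : Γ.IsBipartite)
    (hD : 4 ≤ Γ.diam) (hk : 3 ≤ DRG.b Γ 0) (x : X)
    (n : ℕ) (hn : n = 1 ∨ (Odd Γ.diam ∧ n = Γ.diam / 2))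
    (W : Submodule ℂ (X → ℂ)) (hW : DRG.IsIrreducibleTModule Γ x W)
    (hthin : DRG.IsThin Γ x W) (hend : DRG.endpoint Γ x W = 2)
    (hη : DRG.HasLocalEigenvalue Γ x W (DRG.tilde Γ (DRG.eigenvalue Γ n)))
    (v : X → ℂ) (hv : v ∈ DRG.dualComponent Γ x W 2) (hv0 : v ≠ 0) :
    (∀ i : ℕ, 1 ≤ i → i ≤ Γ.diam - 4 →
      DRG.c Γ i ≠ 0 ∧ (DRG.p Γ i).eval (DRG.eigenvalue Γ n) ≠ 0 ∧
        (DRG.p Γ (i + 1)).eval (DRG.eigenvalue Γ n) ≠ 0) ∧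
    ∃ B : Module.Basis (Fin (Γ.diam - 3)) ℂ W,
      (∀ i : Fin (Γ.diam - 3), (B i : X → ℂ) =
        (DRG.dualIdempotent Γ x ((i : ℕ) + 2) * DRG.distanceMatrix Γ i) *ᵥ v) ∧
      LinearMap.toMatrix B B (DRG.adjacencyOn Γ x W hW.isTModule) =
        DRG.tridiagonal Γ (DRG.eigenvalue Γ n) := by
  have hpos : 0 < n := by omega
  have hlt : 2 * n < Γ.diam := by grind
  exact mainTheorem9_general Γ hΓ hbip hD x _
    (hΓ.eigenvalue_mem_spectrum hbip (by omega) (by omega)) (hΓ.eigenvalue_pos hbip hlt).ne'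
    (hΓ.eigenvalue_sq_lt hbip hpos hlt).ne (hΓ.eigenvalue_sq_ne_b_two hbip hD hn) W hW hthin hend
    hη v hv hv0
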